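/- **Setting.** Let $U=\{u_1,\dots,u_n\}$, $V=\{v_1,\dots,v_n\}$, and let $G\sim\mathcal G(n,n,p)$ be the random bipartite graph in which each edge $(u_i,v_j)$ is present independently with probability $p$. Let $d_G$ be its shortest path distance on $[2n]=U\cup V$ (with value $\infty$ between different components), and let $N(v_i)\subseteq U$ be the neighborhood of $v_i$. For $c>1$, $x\in\mathbb Z^{2n}$ and $q\in[2n]$ let $\mathrm{AFN}^{1,c}_G(x,q)$ be $1$ if $x\ge 0$ and $\max\{d_G(q,i):x_i>0\}\ge c$; be $0$ if $x\ge 0$ and $\max\{d_G(q,i):x_i>0\}\le 1$; and be $*$ otherwise (the maximum over the empty set is $0$). For $k\ge 1$ let $I^*(G)=\{i\in[n]: d_G(u_i,v_i)\ge 2k+1\}$. For $\mathsf P,\mathsf U\in\mathbb N_{\ge 1}$ and $I^*(G)\neq\emptyset$, the distribution $\mathcal D(G)$ on $\mathbb Z^{2n}$ is that of the following $\mathbf x$: draw $\mathbf i$ uniformly from $I^*(G)$; the coordinate of $u_{\mathbf i}$ is $0$ or $\mathsf P$ with probability $1/2$ each; independently, for each $u_j\in N(v_{\mathbf i})$ the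 coordinate of $u_j$ is uniform in $\{1,\dots,\mathsf P\mathsf U\}$; all other coordinates, in particular those of $V$, are $0$. For sketches with $s$ rows the parameters are any $\mathsf P=M!$ with $M\ge (s^2(2n)^{2n})^s$ and any $\mathsf U\geq 1$ with $\mathsf U\ge n(s^2(2n)^{2n})^{s+1}$. **Lemma.** There are absolute constants $a\in\mathbb N$ and $C>0$ such that for every constant $K$ there is a sequence $\varepsilon(n)\to 0$ for which the following holds. Let $n,k\in\mathbb N$ with $k\ge1$, let $1<c\le 2k+1$, and let $p=n^{1/(2k-1)-1}/\log^5 n$, where $p\in[0,1]$. Then with probability at least $1-\varepsilon(n)$ over $G\sim\mathcal G(n,n,p)$ the set $I^*(G)$ is nonempty, and for all $s$ and all $\mathsf P,\mathsf U$ as above, any pair $(T,\mathrm{Dec})$ which satisfies * $T\in\mathbb Z^{s\times 2n}$ has all its entries bounded by $K(2n)^n$ in absolute value, and * $\mathrm{Dec}:\mathbb Z^s\times[2n]\to\{0,1\}$ is such that the probability over $\mathbf x\sim\mathcal D(G)$ that there is a $q\in[2n]$ with $\mathrm{AFN}^{1,c}_G(\mathbf x,q)\in\{0,1\}$ and $\mathrm{Dec}(T\mathbf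 x,q)\ne\mathrm{AFN}^{1,c}_G(\mathbf x,q)$ is at most $1/(200n)$, must have $s\ge C\,n^{1/(2k-1)}/\log^a n$, i.e. $s\ge\tilde\Omega(n^{1/(2k-1)})$. -/

import Mathlib

open MeasureTheory
open scoped ENNReal

noncomputable section

/-- The `2n` points: `Sum.inl i` is the left vertex `u_i`, `Sum.inr j` is the right vertex `v_j`. -/
abbrev BipVertex (n : ℕ) : Type := Fin n ⊕ Fin n

/-- The bipartite graph in which `u_i` and `v_j` are adjacent exactly when `E (i, j) = true`. -/
def bipGraph {n : ℕ} (E : Fin n × Fin n → Bool) : SimpleGraph (BipVertex n) where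
  Adj
    | Sum.inl i, Sum.inr j => E (i, j) = true
    | Sum.inr j, Sum.inl i => E (i, j) = true
    | _, _ => False
  symm := ⟨by rintro (i | i) (j | j) h <;> exact h⟩
  loopless := ⟨by rintro (i | i) h <;> exact h⟩

/-- The law of the random bipartite graph `G(n,n,p)`, given by its edge indicators: each of the
`n ^ 2` possible edges is present independently with probability `p`. -/
def randomBipartite (n : ℕ) (p : unitInterval) : Measure (Fin n × Fin n → Bool) :=
  Measure.pi fun _ => ProbabilityTheory.bernoulliMeasure true false p

/-- The shortest path distance of the bipartite graph (`∞` between different components). -/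
def graphDist {n : ℕ} (E : Fin n × Fin n → Bool) (a b : BipVertex n) : ℝ≥0∞ :=
  ((bipGraph E).edist a b : ℝ≥0∞)

/-- `max {d(q,i) : x_i > 0}`; it is `0` if no `x_i` is positive. -/
def furthestDist {ι : Type*} (d : ι → ι → ℝ≥0∞) (x : ι → ℤ) (q : ι) : ℝ≥0∞ :=
  ⨆ i : ι, ⨆ _ : 0 < x i, d q i

open Classical in
/-- The approximate furthest neighbor function `AFN^{r,c}` of the distance function `d`. The values
`1`, `0` and `*` are `some true`, `some false` and `none`. -/
def afn {ι : Type*} (d : ι → ι → ℝ≥0∞) (r c : ℝ) (x : ι → ℤ) (q : ι) : Option Bool :=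
  if (∀ i, 0 ≤ x i) ∧ ENNReal.ofReal (c * r) ≤ furthestDist d x q then some true
  else if (∀ i, 0 ≤ x i) ∧ furthestDist d x q ≤ ENNReal.ofReal r then some false
  else none

open Classical in
/-- `I^*(G)`: the indices `i` for which `u_i` and `v_i` are at distance at least `2k+1`. -/
def farIndices {n : ℕ} (k : ℕ) (E : Fin n × Fin n → Bool) : Finset (Fin n) :=
  Finset.univ.filter fun i => ((2 * k + 1 : ℕ) : ℝ≥0∞) ≤ graphDist E (Sum.inl i) (Sum.inr i)

/-- The input made from a hidden index `i`, a bit `b` and values `y`: the coordinate of `u_i` is `P`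
if `b` is true and `0` otherwise, that of any other `u_j` is `y_j` if `u_j` is a neighbor of `v_i`
and `0` otherwise, and the coordinates of all the `v_j` are `0`. -/
def hardInput {n : ℕ} (E : Fin n × Fin n → Bool) (P : ℕ) (i : Fin n) (b : Bool)
    (y : Fin n → ℕ) : BipVertex n → ℤ
  | Sum.inl j => if j = i then (if b then (P : ℤ) else 0)
      else if E (j, i) = true then (y j : ℤ) else 0
  | Sum.inr _ => 0

/-- The choices behind a hard input: `i ∈ I^*(G)`, a bit, and one value in `{1, …, P * U}` for every
index. -/
def hardChoices {n : ℕ} (k : ℕ) (E : Fin n × Fin n → Bool) (P U : ℕ) :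
    Finset (Fin n × Bool × (Fin n → ℕ)) :=
  farIndices k E ×ˢ (Finset.univ : Finset Bool) ×ˢ
    Fintype.piFinset fun _ : Fin n => Finset.Icc 1 (P * U)

theorem hardChoices_nonempty {n k : ℕ} {E : Fin n × Fin n → Bool} {P U : ℕ}
    (hI : (farIndices k E).Nonempty) (hP : 0 < P) (hU : 0 < U) :
    (hardChoices k E P U).Nonempty :=
  hI.product (Finset.univ_nonempty.product
    (Fintype.piFinset_nonempty.2 fun _ => Finset.nonempty_Icc.2 (Nat.mul_pos hP hU)))

/-- The hard distribution `D(G)` with parameters `P` and `U`: the law of the hard input for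
independent uniform choices of `i ∈ I^*(G)`, of the bit, and of the values in `{1, …, P * U}`. -/
def hardDist {n : ℕ} (k : ℕ) (E : Fin n × Fin n → Bool) (P U : ℕ)
    (hI : (farIndices k E).Nonempty) (hP : 0 < P) (hU : 0 < U) : PMF (BipVertex n → ℤ) :=
  (PMF.uniformOfFinset (hardChoices k E P U) (hardChoices_nonempty hI hP hU)).map
    fun t => hardInput E P t.1 t.2.1 t.2.2

/-- The set of inputs `x` on which the linear sketch `(T, Dec)` answers some query `q` wrongly, that
is, `AFN^{1,c}(x,q)` is `0` or `1` and `Dec (T x, q)` is not this value. -/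
def sketchErrors {n s : ℕ} (E : Fin n × Fin n → Bool) (c : ℝ)
    (T : Matrix (Fin s) (BipVertex n) ℤ) (Dec : (Fin s → ℤ) → BipVertex n → Bool) :
    Set (BipVertex n → ℤ) :=
  {x | ∃ (q : BipVertex n) (b : Bool),
    afn (graphDist E) 1 c x q = some b ∧ Dec (T.mulVec x) q ≠ b}

/-- The property of the graph with edge indicators `E`: the set `I^*(G)` is nonempty, so that the
distributions `D(G)` exist, and every integer linear sketch `(T, Dec)` with `s` rows and entries of
magnitude at most `K (2n)^n`, which is wrong on some query with probability at most `1/(200n)` over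
`D(G)`, has `s ≥ B`. The parameters of `D(G)` are `P = M!` for an `M` that is at least
`(s^2 (2n)^(2n))^s`, and a positive `U` that is at least `n (s^2 (2n)^(2n))^(s+1)`. -/
def AFNSketchBound {n : ℕ} (k : ℕ) (c K B : ℝ) (E : Fin n × Fin n → Bool) : Prop :=
  ∃ hI : (farIndices k E).Nonempty,
    ∀ (s M U : ℕ) (hU : 0 < U),
      (s ^ 2 * (2 * n) ^ (2 * n)) ^ s ≤ M →
      n * (s ^ 2 * (2 * n) ^ (2 * n)) ^ (s + 1) ≤ U →
      ∀ (T : Matrix (Fin s) (BipVertex n) ℤ) (Dec : (Fin s → ℤ) → BipVertex n → Bool),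
        (∀ a b, |(T a b : ℝ)| ≤ K * (2 * (n : ℝ)) ^ n) →
        (hardDist k E M.factorial U hI (Nat.factorial_pos M) hU).toMeasure.real
          (sketchErrors E c T Dec) ≤ 1 / (200 * (n : ℝ)) →
        B ≤ (s : ℝ)

end

/-! Write t_j for the column of T at u_j. Suppose that u_i and v_i are far apart and t_i lies in the
rational span of the columns of the neighbors of v_i. Cramer's rule gives an integer relation d t_i
= Σ z_j t_j with bounded d ≠ 0 and z. Then d divides P = M!, so P t_i is an integer combination of
the neighbor columns. Translating the uniform values by its coefficients turns at least three
quarters of the inputs with hidden index i and bit 1 into inputs with bit 0 and the same sketch,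
although the answers to the query v_i differ. This costs an error of 3/(8n) (`three_le_error`), so
for an accurate sketch t_i is outside the span (`notMem_span_of_error_le`).

Functionals f_i that vanish on the neighbor columns but not on t_i then give a matrix (f_i(t_j)) of
rank at most s, zero at every transposed edge and nonzero at the far diagonal positions. What
remains is a minrank bound for a random graph. Pass to a principal part whose ratio of rank to size
is least. Minimality yields a row basis and a column basis that are no denser than the average
(`exists_light_basis`). Up to a nonzero factor, the q nonzero entries in these rows and columns
determine the principal part by polynomials of low degree, so only n^{O(q)} supports can occur,
while each support has at least nq/(4s) positions (`exists_skeletonPattern`). A given support misses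
all edges with probability at most exp(-pnq/(4s)), which beats the count once s is below np/(100 log
n) (`randomBipartite_sparsePatternEvent_le`).

Finally, p is so small that u_i and v_i are joined by a path of length below 2k+1 with probability
at most 2/log^5 n; by Markov's inequality at least half of the indices are far, with high
probability. -/

/-! ### Counting the nonvanishing patterns of polynomials -/

open Classical in
/-- The nonvanishing patterns of a finite family of polynomials: the sets of indices of the
polynomials that do not vanish at some common point. -/
noncomputable def nonvanishingPatterns {ι σ F : Type*} [Fintype ι] [Field F] (f : ι → MvPolynomial σ F) :
    Finset (Finset ι) :=
  Finset.univ.filter fun Z => ∃ x : σ → F, ∀ i, i ∈ Z ↔ MvPolynomial.eval x (f i) ≠ 0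

theorem mem_nonvanishingPatterns {ι σ F : Type*} [Fintype ι] [Field F]
    {f : ι → MvPolynomial σ F} {Z : Finset ι} : Z ∈ nonvanishingPatterns f ↔
      ∃ x : σ → F, ∀ i, i ∈ Z ↔ MvPolynomial.eval x (f i) ≠ 0 := by
  simp [nonvanishingPatterns]

/-- The products of the polynomials over the nonvanishing patterns are linearly independent. -/
theorem linearIndependent_prod_nonvanishingPatterns {ι σ F : Type*} [Fintype ι] [Field F]
    (f : ι → MvPolynomial σ F) :
    LinearIndependent F fun Z : nonvanishingPatterns f => ∏ i ∈ Z.1, f i := by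
  classical
  rw [Fintype.linearIndependent_iff]
  intro c hc
  by_contra! hne
  obtain ⟨Z₀, hZ₀⟩ := hne
  -- Take a pattern of least size with nonzero coefficient and evaluate at its witness: any other
  -- product in the relation has a factor outside this pattern, hence vanishes.
  obtain ⟨Z, hZ, hmin⟩ := Finset.exists_min_image
    (Finset.univ.filter fun Z : nonvanishingPatterns f => c Z ≠ 0) (fun Z => Z.1.card)
    ⟨Z₀, by simpa using hZ₀⟩
  simp only [Finset.mem_filter, Finset.mem_univ, true_and] at hZ hmin
  obtain ⟨x, hx⟩ := mem_nonvanishingPatterns.1 Z.2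
  have h := congrArg (MvPolynomial.eval x) hc
  rw [map_sum, map_zero, Finset.sum_eq_single Z] at h
  · rw [MvPolynomial.smul_eval, map_prod] at h
    rcases mul_eq_zero.1 h with h | h
    · exact hZ h
    · obtain ⟨i, hi, h0⟩ := Finset.prod_eq_zero_iff.1 h
      exact (hx i).1 hi h0
  · intro W _ hWZ
    rw [MvPolynomial.smul_eval, map_prod]
    by_cases hcW : c W = 0
    · simp [hcW]
    have hsub : ¬ W.1 ⊆ Z.1 := fun hs =>
      hWZ (Subtype.ext (Finset.eq_of_subset_of_card_le hs (hmin W hcW)))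
    obtain ⟨i, hiW, hiZ⟩ := Finset.not_subset.1 hsub
    have h0 : MvPolynomial.eval x (f i) = 0 := by
      by_contra h0
      exact hiZ ((hx i).2 h0)
    rw [Finset.prod_eq_zero hiW h0, mul_zero]
  · simp

/-- A linearly independent family of polynomials in `q` variables of total degree at most `D` has at
most `(D + 1) ^ q` members. -/
theorem card_le_of_linearIndependent_of_totalDegree_le {κ F : Type*} [Fintype κ] [Field F] {q D : ℕ}
    {g : κ → MvPolynomial (Fin q) F} (hg : LinearIndependent F g)
    (hD : ∀ a, (g a).totalDegree ≤ D) : Fintype.card κ ≤ (D + 1) ^ q := by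
  classical
  -- A polynomial of total degree at most D is determined by its coefficients at exponents in the
  -- box {0, …, D}^q, so independence passes to these coefficient vectors.
  have hli : LinearIndependent F fun a => fun e : Fin q → Fin (D + 1) =>
      MvPolynomial.coeff (Finsupp.equivFunOnFinite.symm fun t => (e t : ℕ)) (g a) := by
    rw [Fintype.linearIndependent_iff] at hg ⊢
    intro c hc
    refine hg c ?_
    ext m
    rw [MvPolynomial.coeff_sum, MvPolynomial.coeff_zero]
    by_cases hm : ∀ t, m t < D + 1
    · have := congrFun hc fun t => ⟨m t, hm t⟩
      simp only [Finset.sum_apply, Pi.smul_apply, Pi.zero_apply] at this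
      simp only [MvPolynomial.coeff_smul]
      have hm' : (Finsupp.equivFunOnFinite.symm fun t => m t) = m := by ext; rfl
      rwa [hm'] at this
    · push Not at hm
      obtain ⟨t, ht⟩ := hm
      refine Finset.sum_eq_zero fun a _ => ?_
      rw [MvPolynomial.coeff_smul, MvPolynomial.coeff_eq_zero_of_totalDegree_lt, smul_zero]
      refine (hD a).trans_lt (lt_of_lt_of_le (Nat.lt_of_succ_le ht) ?_)
      exact Finset.single_le_sum (f := fun i => m i) (fun _ _ => Nat.zero_le _)
        (Finsupp.mem_support_iff.2 (by omega))
  simpa using hli.fintype_card_le_finrank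

/-- The number of nonvanishing patterns of polynomials in `q` variables of total degree at most
`d`. -/
theorem card_nonvanishingPatterns_le {ι F : Type*} [Fintype ι] [Field F] {q d : ℕ}
    (f : ι → MvPolynomial (Fin q) F) (hf : ∀ i, (f i).totalDegree ≤ d) :
    (nonvanishingPatterns f).card ≤ (Fintype.card ι * d + 1) ^ q := by
  have := card_le_of_linearIndependent_of_totalDegree_le (D := Fintype.card ι * d)
    (linearIndependent_prod_nonvanishingPatterns f) fun Z => by
      refine (MvPolynomial.totalDegree_finsetProd _ _).trans ?_
      refine (Finset.sum_le_card_nsmul _ _ d fun i _ => hf i).trans ?_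
      exact Nat.mul_le_mul_right _ (Finset.card_le_univ _)
  simpa using this

/-! ### Skeleton polynomials and their degrees -/

/-- The determinant of a matrix of polynomials of total degree at most one. -/
theorem totalDegree_det_le {r : ℕ} {σ F : Type*} [Field F]
    (A : Matrix (Fin r) (Fin r) (MvPolynomial σ F)) (hA : ∀ i j, (A i j).totalDegree ≤ 1) :
    A.det.totalDegree ≤ r := by
  rw [Matrix.det_apply]
  refine MvPolynomial.totalDegree_finsetSum_le fun τ _ => ?_
  refine (MvPolynomial.totalDegree_smul_le _ _).trans ?_
  refine (MvPolynomial.totalDegree_finsetProd _ _).trans ?_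
  refine (Finset.sum_le_card_nsmul _ _ 1 fun i _ => hA _ _).trans ?_
  simp

/-- An adjugate entry is the determinant after a row is replaced by a unit vector, and constants
keep the entries of degree at most one. The sharper r - 1 is not needed. -/
theorem totalDegree_adjugate_le {r : ℕ} {σ F : Type*} [Field F]
    (A : Matrix (Fin r) (Fin r) (MvPolynomial σ F)) (hA : ∀ i j, (A i j).totalDegree ≤ 1)
    (i j : Fin r) : (A.adjugate i j).totalDegree ≤ r := by
  rw [Matrix.adjugate_apply]
  refine totalDegree_det_le _ fun a b => ?_
  rw [Matrix.updateRow_apply]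
  split_ifs
  · by_cases h : b = i
    · subst h; simp
    · simp [h]
  · exact hA _ _

theorem totalDegree_matrix_mul_le {l m o : Type*} [Fintype m] {σ F : Type*} [Field F] {a b : ℕ}
    (A : Matrix l m (MvPolynomial σ F)) (B : Matrix m o (MvPolynomial σ F))
    (hA : ∀ i j, (A i j).totalDegree ≤ a) (hB : ∀ i j, (B i j).totalDegree ≤ b) (i : l) (j : o) :
    ((A * B) i j).totalDegree ≤ a + b := by
  rw [Matrix.mul_apply]
  refine MvPolynomial.totalDegree_finsetSum_le fun k _ => ?_
  exact (MvPolynomial.totalDegree_mul _ _).trans (add_le_add (hA _ _) (hB _ _))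

/-- The matrix with the variable `t` in position `g t`, and zeros elsewhere. -/
noncomputable def sparseMatrix {n q : ℕ} (F : Type*) [Field F] (g : Fin q → Fin n × Fin n) :
    Matrix (Fin n) (Fin n) (MvPolynomial (Fin q) F) :=
  Matrix.of fun i j => ∑ t : Fin q, if g t = (i, j) then MvPolynomial.X t else 0

/-- The matrix recovered, up to a factor, from its rows `b` and its columns `c`, when the entries in
these are the variables placed by `g`. -/
noncomputable def skeletonMatrix {n q r : ℕ} (F : Type*) [Field F] (b c : Fin r → Fin n)
    (g : Fin q → Fin n × Fin n) : Matrix (Fin n) (Fin n) (MvPolynomial (Fin q) F) :=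
  (sparseMatrix F g).submatrix id c * ((sparseMatrix F g).submatrix b c).adjugate *
    (sparseMatrix F g).submatrix b id

theorem totalDegree_skeletonMatrix_le {n q r : ℕ} (F : Type*) [Field F] (b c : Fin r → Fin n)
    (g : Fin q → Fin n × Fin n) (i j : Fin n) :
    (skeletonMatrix F b c g i j).totalDegree ≤ r + 2 := by
  have h1 : ∀ i j, (sparseMatrix F g i j).totalDegree ≤ 1 := fun i j => by
    rw [sparseMatrix, Matrix.of_apply]
    refine MvPolynomial.totalDegree_finsetSum_le fun t _ => ?_
    split_ifs
    · simp
    · simp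
  have h := totalDegree_matrix_mul_le (a := 1 + r) (b := 1)
    ((sparseMatrix F g).submatrix id c * ((sparseMatrix F g).submatrix b c).adjugate)
    ((sparseMatrix F g).submatrix b id)
    (totalDegree_matrix_mul_le _ _ (fun _ _ => h1 _ _)
      (totalDegree_adjugate_le _ fun _ _ => h1 _ _)) (fun _ _ => h1 _ _) i j
  exact h.trans (by omega)

/-- The nonvanishing patterns of the entries of `skeletonMatrix`. -/
noncomputable def skeletonPatterns {n q r : ℕ} (b c : Fin r → Fin n) (g : Fin q → Fin n × Fin n) :
    Finset (Finset (Fin n × Fin n)) :=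
  nonvanishingPatterns fun z : Fin n × Fin n => skeletonMatrix ℚ b c g z.1 z.2

theorem card_skeletonPatterns_le {n q r : ℕ} (b c : Fin r → Fin n) (g : Fin q → Fin n × Fin n) :
    (skeletonPatterns b c g).card ≤ (n * n * (r + 2) + 1) ^ q := by
  simpa [skeletonPatterns] using card_nonvanishingPatterns_le _
    fun z : Fin n × Fin n => totalDegree_skeletonMatrix_le ℚ b c g z.1 z.2

/-! ### Bases of small weight -/

theorem finrank_span_image_le_card {ι F V : Type*} [Field F] [AddCommGroup V] [Module F V]
    (v : ι → V) (B : Finset ι) :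
    Module.finrank F (Submodule.span F (v '' (B : Set ι))) ≤ B.card := by
  classical
  rw [← Finset.coe_image]
  exact (finrank_span_finset_le_card (B.image v)).trans Finset.card_image_le

theorem finrank_span_image_eq_card {ι F V : Type*} [Field F] [AddCommGroup V] [Module F V]
    {v : ι → V} {B : Finset ι} (h : LinearIndepOn F v (B : Set ι)) :
    Module.finrank F (Submodule.span F (v '' (B : Set ι))) = B.card := by
  have := finrank_span_eq_card h
  rwa [show Set.range (fun x : (B : Set ι) => v x) = v '' (B : Set ι) by
    rw [Set.image_eq_range], ← Nat.card_eq_fintype_card, Nat.card_coe_set_eq,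
    Set.ncard_coe_finset] at this

/-- A basis chosen in the order of increasing weight spans every sublevel set of the weight. -/
theorem exists_linearIndepOn_filtered {ι F V : Type*} [Field F] [AddCommGroup V] [Module F V]
    (v : ι → V) (A : Finset ι) (w : ι → ℕ) (N : ℕ) :
    ∃ B ⊆ A.filter (w · ≤ N), LinearIndepOn F v (B : Set ι) ∧
      ∀ t ≤ N, v '' (A.filter (w · ≤ t) : Set ι) ⊆
        Submodule.span F (v '' (B.filter (w · ≤ t) : Set ι)) := by
  classical
  -- Greedy step: a basis of the previous sublevel set extends to one of the next.
  have ext : ∀ (N : ℕ) (B₀ : Finset ι), B₀ ⊆ A.filter (w · ≤ N) → LinearIndepOn F v (B₀ : Set ι) →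
      ∃ B ⊆ A.filter (w · ≤ N), B₀ ⊆ B ∧ LinearIndepOn F v (B : Set ι) ∧
        v '' (A.filter (w · ≤ N) : Set ι) ⊆ Submodule.span F (v '' (B.filter (w · ≤ N) : Set ι)) := by
    intro N B₀ h₀ hli
    obtain ⟨b, hbt, hsb, hsp, hb⟩ := exists_linearIndepOn_extension hli (Finset.coe_subset.2 h₀)
    lift b to Finset ι using (Finset.finite_toSet _).subset hbt
    refine ⟨b, Finset.coe_subset.1 hbt, Finset.coe_subset.1 hsb, hb, ?_⟩
    rwa [Finset.filter_true_of_mem fun i hi => (Finset.mem_filter.1 (hbt hi)).2]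
  induction N with
  | zero =>
    obtain ⟨B, hB, -, hli, hsp⟩ := ext 0 ∅ (by simp) (by simp)
    refine ⟨B, hB, hli, fun t ht => ?_⟩
    obtain rfl := Nat.le_zero.1 ht
    exact hsp
  | succ N ih =>
    obtain ⟨B₀, hB₀, hli₀, h₀⟩ := ih
    obtain ⟨B, hB, hsub, hli, hsp⟩ := ext (N + 1) B₀
      (hB₀.trans (Finset.monotone_filter_right _ fun i _ h => Nat.le_succ_of_le h)) hli₀
    refine ⟨B, hB, hli, fun t ht => ?_⟩
    rcases Nat.le_succ_iff.1 ht with h | rfl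
    · refine (h₀ t h).trans (Submodule.span_mono (Set.image_mono ?_))
      exact_mod_cast Finset.filter_subset_filter _ hsub
    · exact hsp

/-- Layer-cake summation: an index of weight w is counted once for every threshold t < w. -/
theorem sum_eq_sum_card_filter_lt {ι : Type*} (A : Finset ι) (w : ι → ℕ) (N : ℕ)
    (hN : ∀ i ∈ A, w i ≤ N) :
    ∑ i ∈ A, w i = ∑ t ∈ Finset.range N, (A.filter fun i => ¬ w i ≤ t).card := by
  simp_rw [Finset.card_filter]
  rw [Finset.sum_comm]
  refine Finset.sum_congr rfl fun i hi => ?_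
  rw [← Finset.card_filter]
  have : (Finset.range N).filter (fun t => ¬ w i ≤ t) = Finset.range (w i) := by
    ext t
    have := hN i hi
    simp only [Finset.mem_filter, Finset.mem_range]
    omega
  rw [this, Finset.card_range]

/-- If no subfamily has a smaller ratio of rank to size than the whole family, then some basis has
at most the average weight. -/
theorem exists_light_basis {ι F V : Type*} [Field F] [AddCommGroup V] [Module F V]
    (v : ι → V) (A : Finset ι) (w : ι → ℕ) (r : ℕ)
    (hr : Module.finrank F (Submodule.span F (v '' (A : Set ι))) = r)
    (hA : ∀ A' ⊆ A, r * A'.card ≤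
      Module.finrank F (Submodule.span F (v '' (A' : Set ι))) * A.card) :
    ∃ B ⊆ A, B.card = r ∧ LinearIndepOn F v (B : Set ι) ∧
      v '' (A : Set ι) ⊆ Submodule.span F (v '' (B : Set ι)) ∧
      A.card * ∑ i ∈ B, w i ≤ r * ∑ i ∈ A, w i := by
  classical
  set N := A.sup w with hN
  have hwN : ∀ i ∈ A, w i ≤ N := fun i hi => Finset.le_sup hi
  obtain ⟨B, hB, hli, hsp⟩ := exists_linearIndepOn_filtered (F := F) v A w N
  have hBA : B ⊆ A := hB.trans (Finset.filter_subset _ _)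
  have hspan : v '' (A : Set ι) ⊆ Submodule.span F (v '' (B : Set ι)) := by
    have := hsp N le_rfl
    rwa [Finset.filter_true_of_mem hwN,
      Finset.filter_true_of_mem fun i hi => hwN i (hBA hi)] at this
  have hcard : B.card = r := by
    rw [← hr, ← finrank_span_image_eq_card hli]
    rw [le_antisymm (Submodule.span_mono (Set.image_mono (by exact_mod_cast hBA)))
      (Submodule.span_le.2 hspan)]
  refine ⟨B, hBA, hcard, hli, hspan, ?_⟩
  -- Compare threshold by threshold. The ratio hypothesis for the sublevel set of A, which is
  -- spanned by the sublevel set of B, says that B has at least its proportional share of indices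
  -- below t, hence at most its share above.
  rw [sum_eq_sum_card_filter_lt A w N hwN,
    sum_eq_sum_card_filter_lt B w N fun i hi => hwN i (hBA hi), Finset.mul_sum, Finset.mul_sum]
  refine Finset.sum_le_sum fun t ht => ?_
  have h1 := Finset.card_filter_add_card_filter_not (s := B) (fun i => w i ≤ t)
  have h2 := Finset.card_filter_add_card_filter_not (s := A) (fun i => w i ≤ t)
  have h3 := hA (A.filter (w · ≤ t)) (Finset.filter_subset _ _)
  have h4 : Module.finrank F (Submodule.span F (v '' (A.filter (w · ≤ t) : Set ι))) ≤
      (B.filter (w · ≤ t)).card := by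
    refine le_trans ?_ (finrank_span_image_le_card (F := F) v _)
    have : FiniteDimensional F (Submodule.span F (v '' (B.filter (w · ≤ t) : Set ι))) :=
      FiniteDimensional.span_of_finite F ((Finset.finite_toSet _).image v)
    exact Submodule.finrank_mono (Submodule.span_le.2 (hsp t (Finset.mem_range.1 ht).le))
  rw [hcard] at h1
  have h5 := Nat.mul_le_mul_right A.card h4
  have h6 := congrArg (A.card * ·) h1
  have h7 := congrArg (r * ·) h2
  simp only [mul_add] at h6 h7
  linarith

/-! ### Recovering a matrix from spanning rows and columns -/

/-- A matrix of rank `r` is determined by `r` rows and `r` columns that span its row space and its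
column space. -/
theorem det_ne_zero_and_skeleton {n r : ℕ} (M : Matrix (Fin n) (Fin n) ℚ) (hM : M.rank = r)
    (b c : Fin r → Fin n)
    (hb : ∀ i, M i ∈ Submodule.span ℚ (Set.range fun a => M (b a)))
    (hc : ∀ j, M.transpose j ∈ Submodule.span ℚ (Set.range fun a => M.transpose (c a))) :
    (M.submatrix b c).det ≠ 0 ∧
      M.submatrix id c * (M.submatrix b c).adjugate * M.submatrix b id =
        (M.submatrix b c).det • M := by
  choose P hP using fun i => (Submodule.mem_span_range_iff_exists_fun ℚ).1 (hb i)
  choose N hN using fun j => (Submodule.mem_span_range_iff_exists_fun ℚ).1 (hc j)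
  have h1 : Matrix.of P * M.submatrix b id = M := by
    ext i j
    rw [← hP i]
    simp [Matrix.mul_apply, Finset.sum_apply]
  have h2 : M.submatrix id c * (Matrix.of N).transpose = M := by
    ext i j
    have := congrFun (hN j) i
    simp only [Finset.sum_apply, Pi.smul_apply, Matrix.transpose_apply, smul_eq_mul] at this
    rw [← this]
    simp [Matrix.mul_apply, mul_comm]
  have h3 : M.submatrix id c = Matrix.of P * M.submatrix b c := by
    conv_lhs => rw [← h1]
    rw [Matrix.submatrix_mul (he₂ := Function.bijective_id)]
    rfl
  have h4 : M.submatrix b id = M.submatrix b c * (Matrix.of N).transpose := by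
    conv_lhs => rw [← h2]
    rw [Matrix.submatrix_mul (he₂ := Function.bijective_id)]
    rfl
  have h5 : M = Matrix.of P * (M.submatrix b c * (Matrix.of N).transpose) := by rw [← h4, h1]
  -- M factors through the r × r block, which therefore has full rank.
  have hrank : (M.submatrix b c).rank = r := by
    refine le_antisymm (by simpa using (M.submatrix b c).rank_le_card_width) ?_
    calc r = M.rank := hM.symm
      _ ≤ (M.submatrix b c * (Matrix.of N).transpose).rank := by
        conv_lhs => rw [h5]
        exact Matrix.rank_mul_le_right _ _
      _ ≤ _ := Matrix.rank_mul_le_left _ _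
  have hdet : (M.submatrix b c).det ≠ 0 := by
    have hli : LinearIndependent ℚ (M.submatrix b c).row := by
      rw [linearIndependent_iff_card_eq_finrank_span, Set.finrank,
        ← Matrix.rank_eq_finrank_span_row, hrank, Fintype.card_fin]
    exact ((Matrix.isUnit_iff_isUnit_det _).1 (Matrix.linearIndependent_rows_iff_isUnit.1 hli)).ne_zero
  refine ⟨hdet, ?_⟩
  rw [h3, h4]
  calc Matrix.of P * M.submatrix b c * (M.submatrix b c).adjugate *
        (M.submatrix b c * (Matrix.of N).transpose)
      = Matrix.of P * (M.submatrix b c * (M.submatrix b c).adjugate) *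
        (M.submatrix b c * (Matrix.of N).transpose) := by simp only [Matrix.mul_assoc]
    _ = (M.submatrix b c).det • (Matrix.of P * (M.submatrix b c * (Matrix.of N).transpose)) := by
      rw [Matrix.mul_adjugate, Matrix.mul_smul, Matrix.smul_mul, Matrix.mul_one]
    _ = _ := by rw [← h5]

/-! ### Principal parts and their supports -/

/-- The principal part of a matrix on the index set `A`, extended by zeros. -/
def principalPart {n : ℕ} (M : Matrix (Fin n) (Fin n) ℚ) (A : Finset (Fin n)) :
    Matrix (Fin n) (Fin n) ℚ :=
  Matrix.of fun i j => if i ∈ A ∧ j ∈ A then M i j else 0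

theorem principalPart_principalPart {n : ℕ} (M : Matrix (Fin n) (Fin n) ℚ) {A' A : Finset (Fin n)}
    (h : A' ⊆ A) : principalPart (principalPart M A) A' = principalPart M A' := by
  ext i j
  simp only [principalPart, Matrix.of_apply]
  split_ifs with h1 h2
  · rfl
  · exact absurd ⟨h h1.1, h h1.2⟩ h2
  · rfl

theorem transpose_principalPart {n : ℕ} (M : Matrix (Fin n) (Fin n) ℚ) (A : Finset (Fin n)) :
    (principalPart M A).transpose = principalPart M.transpose A := by
  ext i j
  simp only [principalPart, Matrix.of_apply, Matrix.transpose_apply, and_comm]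

/-- Erasing the columns outside A is a linear map on rows, so it cannot raise the rank. Thus
minimality of the ratio among principal parts implies the ratio hypothesis on rows in
`exists_light_basis`. -/
theorem rank_principalPart_le {n : ℕ} (M : Matrix (Fin n) (Fin n) ℚ) (A : Finset (Fin n)) :
    (principalPart M A).rank ≤
      Module.finrank ℚ (Submodule.span ℚ ((fun i => M i) '' (A : Set (Fin n)))) := by
  let π : (Fin n → ℚ) →ₗ[ℚ] (Fin n → ℚ) :=
    LinearMap.pi fun j => if j ∈ A then LinearMap.proj j else 0
  rw [Matrix.rank_eq_finrank_span_row]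
  refine le_trans (Submodule.finrank_mono ?_) (Submodule.finrank_map_le π _)
  rw [Submodule.span_le]
  rintro _ ⟨i, rfl⟩
  by_cases hi : i ∈ A
  · refine ⟨M i, Submodule.subset_span ⟨i, hi, rfl⟩, ?_⟩
    ext j
    simp only [π, LinearMap.pi_apply, Matrix.row, principalPart, Matrix.of_apply, hi, true_and]
    split_ifs <;> rfl
  · have : (principalPart M A).row i = 0 := by
      ext j
      simp [Matrix.row, principalPart, hi]
    rw [this]
    exact Submodule.zero_mem _

theorem finrank_span_image_le_rank {n : ℕ} (M : Matrix (Fin n) (Fin n) ℚ) (A : Finset (Fin n)) :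
    Module.finrank ℚ (Submodule.span ℚ ((fun i => M i) '' (A : Set (Fin n)))) ≤ M.rank := by
  rw [Matrix.rank_eq_finrank_span_row]
  exact Submodule.finrank_mono (Submodule.span_mono (Set.image_subset_range _ _))

/-- Among the nonempty subsets of `I` there is one whose principal part has the least ratio of rank
to size. -/
theorem exists_min_rank_ratio {n : ℕ} (M : Matrix (Fin n) (Fin n) ℚ) {I : Finset (Fin n)}
    (hI : I.Nonempty) :
    ∃ A ⊆ I, A.Nonempty ∧ ∀ A' ⊆ I,
      (principalPart M A).rank * A'.card ≤ (principalPart M A').rank * A.card := by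
  obtain ⟨A, hA, hmin⟩ := Finset.exists_min_image (I.powerset.filter Finset.Nonempty)
    (fun A => ((principalPart M A).rank : ℚ) / A.card)
    ⟨I, by simpa using hI⟩
  simp only [Finset.mem_filter, Finset.mem_powerset] at hA hmin
  refine ⟨A, hA.1, hA.2, fun A' hA' => ?_⟩
  rcases A'.eq_empty_or_nonempty with rfl | hne
  · simp
  · have h := hmin A' ⟨hA', hne⟩
    rw [div_le_div_iff₀ (by exact_mod_cast hA.2.card_pos) (by exact_mod_cast hne.card_pos)] at h
    exact_mod_cast h

/-- The positions of the nonzero entries. -/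
def matrixSupport {n : ℕ} (M : Matrix (Fin n) (Fin n) ℚ) : Finset (Fin n × Fin n) :=
  Finset.univ.filter fun z => M z.1 z.2 ≠ 0

theorem mem_matrixSupport {n : ℕ} {M : Matrix (Fin n) (Fin n) ℚ} {z : Fin n × Fin n} :
    z ∈ matrixSupport M ↔ M z.1 z.2 ≠ 0 := by
  simp [matrixSupport]

theorem card_matrixSupport_rows {n : ℕ} (M : Matrix (Fin n) (Fin n) ℚ) (B : Finset (Fin n)) :
    ((matrixSupport M).filter fun z => z.1 ∈ B).card =
      ∑ i ∈ B, (Finset.univ.filter fun j => M i j ≠ 0).card := by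
  rw [matrixSupport, Finset.filter_filter, Finset.card_filter, Fintype.sum_prod_type]
  rw [← Finset.sum_filter_add_sum_filter_not Finset.univ (· ∈ B)]
  rw [Finset.sum_eq_zero (s := Finset.univ.filter (· ∉ B)) fun i hi => by
    simp [(Finset.mem_filter.1 hi).2], add_zero, Finset.filter_mem_eq_inter, Finset.univ_inter]
  refine Finset.sum_congr rfl fun i hi => ?_
  simp [hi, Finset.card_filter]

theorem card_matrixSupport_cols {n : ℕ} (M : Matrix (Fin n) (Fin n) ℚ) (C : Finset (Fin n)) :
    ((matrixSupport M).filter fun z => z.2 ∈ C).card =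
      ∑ j ∈ C, (Finset.univ.filter fun i => M.transpose j i ≠ 0).card := by
  rw [← card_matrixSupport_rows]
  refine Finset.card_bij' (fun z _ => z.swap) (fun z _ => z.swap) ?_ ?_ ?_ ?_ <;>
    simp [mem_matrixSupport]

theorem sum_card_row_le_card_matrixSupport {n : ℕ} (M : Matrix (Fin n) (Fin n) ℚ)
    (B : Finset (Fin n)) :
    ∑ i ∈ B, (Finset.univ.filter fun j => M i j ≠ 0).card ≤ (matrixSupport M).card := by
  rw [← card_matrixSupport_rows]
  exact Finset.card_filter_le _ _

theorem card_matrixSupport_transpose {n : ℕ} (M : Matrix (Fin n) (Fin n) ℚ) :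
    (matrixSupport M.transpose).card = (matrixSupport M).card := by
  refine Finset.card_bij' (fun z _ => z.swap) (fun z _ => z.swap) ?_ ?_ ?_ ?_ <;>
    simp [mem_matrixSupport]

/-- A light set of rows of a principal part whose ratio of rank to size is least. -/
theorem exists_light_rows {n r : ℕ} (M : Matrix (Fin n) (Fin n) ℚ) (A : Finset (Fin n))
    (hr : (principalPart M A).rank = r)
    (hA : ∀ A' ⊆ A, r * A'.card ≤ (principalPart M A').rank * A.card) :
    ∃ B : Finset (Fin n), B.card = r ∧
      LinearIndepOn ℚ (fun i => principalPart M A i) (B : Set (Fin n)) ∧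
      (∀ i, principalPart M A i ∈
        Submodule.span ℚ ((fun i => principalPart M A i) '' (B : Set (Fin n)))) ∧
      A.card * ∑ i ∈ B, (Finset.univ.filter fun j => principalPart M A i j ≠ 0).card ≤
        r * (matrixSupport (principalPart M A)).card := by
  have hrank : Module.finrank ℚ (Submodule.span ℚ
      ((fun i => principalPart M A i) '' (A : Set (Fin n)))) = r := by
    refine le_antisymm (hr ▸ finrank_span_image_le_rank _ _) ?_
    rw [← hr]
    conv_lhs => rw [← principalPart_principalPart M (le_refl A)]
    exact rank_principalPart_le _ _
  obtain ⟨B, -, hBr, hli, hsp, hw⟩ := exists_light_basis (F := ℚ) (fun i => principalPart M A i) A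
    (fun i => (Finset.univ.filter fun j => principalPart M A i j ≠ 0).card) r hrank
    fun A' hA' => (hA A' hA').trans (Nat.mul_le_mul_right _ (by
      rw [← principalPart_principalPart M hA']
      exact rank_principalPart_le _ _))
  refine ⟨B, hBr, hli, fun i => ?_,
    hw.trans (Nat.mul_le_mul_left _ (sum_card_row_le_card_matrixSupport _ _))⟩
  by_cases hi : i ∈ A
  · exact hsp ⟨i, hi, rfl⟩
  · have : principalPart M A i = 0 := by
      ext j
      simp [principalPart, hi]
    rw [this]
    exact Submodule.zero_mem _

theorem span_range_equivFin {n r : ℕ} {V : Type*} [AddCommGroup V] [Module ℚ V] (v : Fin n → V)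
    (B : Finset (Fin n)) (e : Fin r ≃ B) :
    (Set.range fun a => v (e a)) = v '' (B : Set (Fin n)) := by
  ext x
  constructor
  · rintro ⟨a, rfl⟩
    exact ⟨e a, (e a).2, rfl⟩
  · rintro ⟨i, hi, rfl⟩
    exact ⟨e.symm ⟨i, hi⟩, by simp⟩

/-- Evaluating `sparseMatrix` at the entries of `M` gives the entries of `M` in the positions
enumerated by `g`. -/
theorem eval_sparseMatrix {n q : ℕ} (M : Matrix (Fin n) (Fin n) ℚ) (Q : Finset (Fin n × Fin n))
    (e : Fin q ≃ Q) (i j : Fin n) (h : M i j ≠ 0 → (i, j) ∈ Q) :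
    MvPolynomial.eval (fun t => M (e t).1.1 (e t).1.2)
      (sparseMatrix ℚ (fun t => (e t).1) i j) = M i j := by
  rw [sparseMatrix, Matrix.of_apply, map_sum]
  by_cases hQ : (i, j) ∈ Q
  · rw [Finset.sum_eq_single (e.symm ⟨(i, j), hQ⟩)]
    · simp
    · intro t _ ht
      rw [if_neg, map_zero]
      intro h
      exact ht (by rw [Equiv.eq_symm_apply]; exact Subtype.ext h)
    · simp
  · rw [Finset.sum_eq_zero fun t _ => ?_]
    · by_contra h0
      exact hQ (h fun h1 => h0 h1.symm)
    · rw [if_neg, map_zero]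
      intro h
      exact hQ (h ▸ (e t).2)

/-- The support of a matrix is a skeleton pattern, for any rows and columns that span the row space
and the column space, and any enumeration of the nonzero entries in these. -/
theorem matrixSupport_mem_skeletonPatterns {n q r : ℕ} (M : Matrix (Fin n) (Fin n) ℚ)
    (hM : M.rank = r) (b c : Fin r → Fin n) (Q : Finset (Fin n × Fin n)) (e : Fin q ≃ Q)
    (hb : ∀ i, M i ∈ Submodule.span ℚ (Set.range fun a => M (b a)))
    (hc : ∀ j, M.transpose j ∈ Submodule.span ℚ (Set.range fun a => M.transpose (c a)))
    (hQb : ∀ a j, M (b a) j ≠ 0 → (b a, j) ∈ Q) (hQc : ∀ i a, M i (c a) ≠ 0 → (i, c a) ∈ Q) :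
    matrixSupport M ∈ skeletonPatterns b c (fun t => (e t).1) := by
  obtain ⟨hdet, hskel⟩ := det_ne_zero_and_skeleton M hM b c hb hc
  refine mem_nonvanishingPatterns.2 ⟨fun t => M (e t).1.1 (e t).1.2, fun z => ?_⟩
  set φ := MvPolynomial.eval fun t => M (e t).1.1 (e t).1.2 with hφ
  have h1 : ((sparseMatrix ℚ fun t => (e t).1).submatrix id c).map φ = M.submatrix id c := by
    ext i a
    exact eval_sparseMatrix M Q e _ _ (hQc i a)
  have h2 : ((sparseMatrix ℚ fun t => (e t).1).submatrix b id).map φ = M.submatrix b id := by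
    ext a j
    exact eval_sparseMatrix M Q e _ _ (hQb a j)
  have h3 : ((sparseMatrix ℚ fun t => (e t).1).submatrix b c).map φ = M.submatrix b c := by
    ext a j
    exact eval_sparseMatrix M Q e _ _ (hQb a _)
  -- Evaluation commutes with products and adjugates, so the skeleton identity evaluates to a
  -- nonzero multiple of M, which has the same support.
  have h4 : (skeletonMatrix ℚ b c fun t => (e t).1).map φ = (M.submatrix b c).det • M := by
    rw [← hskel, skeletonMatrix, Matrix.map_mul, Matrix.map_mul, h1, h2, ← h3]
    congr 2
    exact RingHom.map_adjugate φ _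
  have h5 : φ (skeletonMatrix ℚ b c (fun t => (e t).1) z.1 z.2) =
      (M.submatrix b c).det * M z.1 z.2 := congrFun (congrFun h4 z.1) z.2
  rw [h5]
  simp [mem_matrixSupport, hdet]

/-- A matrix of small rank with nonzero diagonal entries on half of the indices contains a skeleton
pattern with many positions in relation to its number of variables. -/
theorem exists_skeletonPattern {n s : ℕ} (M : Matrix (Fin n) (Fin n) ℚ) (hr : M.rank ≤ s)
    (I : Finset (Fin n)) (hI : n ≤ 2 * I.card) (hne : I.Nonempty) (hd : ∀ i ∈ I, M i i ≠ 0) :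
    ∃ (r q : ℕ) (b c : Fin r → Fin n) (g : Fin q → Fin n × Fin n) (Z : Finset (Fin n × Fin n)),
      Z ∈ skeletonPatterns b c g ∧ 1 ≤ q ∧ r ≤ q ∧ r ≤ n ∧ q ≤ n * n ∧ n * q ≤ 4 * s * Z.card ∧
      ∀ z ∈ Z, M z.1 z.2 ≠ 0 := by
  classical
  obtain ⟨A, hAI, hAne, hmin⟩ := exists_min_rank_ratio M hne
  set M' := principalPart M A with hM'
  set r := M'.rank with hrdef
  set S := (matrixSupport M').card with hS
  obtain ⟨B, hBr, hBli, hBsp, hBw⟩ := exists_light_rows M A rfl fun A' hA' =>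
    hmin A' (hA'.trans hAI)
  obtain ⟨C, hCr, hCli, hCsp, hCw⟩ := exists_light_rows M.transpose A (r := r)
    (by rw [← transpose_principalPart, Matrix.rank_transpose]) fun A' hA' => by
      rw [← transpose_principalPart, Matrix.rank_transpose]
      exact hmin A' (hA'.trans hAI)
  rw [← transpose_principalPart, card_matrixSupport_transpose] at hCw
  simp only [← transpose_principalPart] at hCw hCsp hCli
  rw [← card_matrixSupport_cols] at hCw
  rw [← card_matrixSupport_rows] at hBw
  simp only [← hM', ← hS, ← hrdef] at hBw hCw hBsp hCsp hBli hBr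
  set Q := (matrixSupport M').filter fun z => z.1 ∈ B ∨ z.2 ∈ C with hQ
  have hmemQ : ∀ i j, (i, j) ∈ Q ↔ M' i j ≠ 0 ∧ (i ∈ B ∨ j ∈ C) := fun i j => by
    simp [hQ, mem_matrixSupport]
  have hrow : ∀ i ∈ B, ∃ j, M' i j ≠ 0 := fun i hi => by
    by_contra! h
    exact hBli.ne_zero hi (funext h)
  -- Each basis row is nonzero and contributes an entry of its own. This later lets n^{2r}, the
  -- number of choices of rows and columns, be absorbed into n^{2q}.
  have hrQ : r ≤ Q.card := by
    rw [← hBr]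
    choose f hf using hrow
    refine Finset.card_le_card_of_injOn (fun i => if h : i ∈ B then (i, f i h) else (i, i)) ?_ ?_
    · intro i hi
      have hi' : i ∈ B := hi
      simp only [hi', dif_pos]
      exact (hmemQ _ _).2 ⟨hf i hi', Or.inl hi'⟩
    · intro i hi i' hi' h
      have h1 : i ∈ B := hi
      have h2 : i' ∈ B := hi'
      simp only [h1, h2, dif_pos] at h
      exact congrArg Prod.fst h
  -- A is nonempty and its diagonal entries are nonzero.
  have hr1 : 1 ≤ r := by
    obtain ⟨a, ha⟩ := hAne
    rw [Nat.one_le_iff_ne_zero]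
    intro h0
    have h1 : B = ∅ := Finset.card_eq_zero.1 (hBr.trans h0)
    have h2 := hBsp a
    rw [h1, Finset.coe_empty, Set.image_empty, Submodule.span_empty, Submodule.mem_bot] at h2
    have h3 := congrFun h2 a
    simp only [hM', principalPart, Matrix.of_apply, ha, and_self, if_true, Pi.zero_apply] at h3
    exact hd a (hAI ha) h3
  have hcardQ : A.card * Q.card ≤ 2 * (r * S) := by
    have : Q.card ≤ ((matrixSupport M').filter fun z => z.1 ∈ B).card +
        ((matrixSupport M').filter fun z => z.2 ∈ C).card := by
      rw [hQ, Finset.filter_or]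
      exact Finset.card_union_le _ _
    calc A.card * Q.card ≤ _ := Nat.mul_le_mul_left _ this
      _ ≤ _ := by rw [mul_add, two_mul]; exact add_le_add hBw hCw
  -- The ratio for A is at most that for I, which is at most s / (n/2).
  have hrn : r * n ≤ 2 * s * A.card := by
    have h1 := hmin I le_rfl
    have h2 : (principalPart M I).rank ≤ s :=
      ((rank_principalPart_le M I).trans (finrank_span_image_le_rank M I)).trans hr
    calc r * n ≤ r * (2 * I.card) := Nat.mul_le_mul_left _ hI
      _ = 2 * (r * I.card) := by ring
      _ ≤ 2 * ((principalPart M I).rank * A.card) := Nat.mul_le_mul_left _ h1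
      _ ≤ 2 * (s * A.card) := Nat.mul_le_mul_left _ (Nat.mul_le_mul_right _ h2)
      _ = _ := by ring
  let eB : Fin r ≃ B := (B.equivFinOfCardEq hBr).symm
  let eC : Fin r ≃ C := (C.equivFinOfCardEq hCr).symm
  refine ⟨r, Q.card, fun a => eB a, fun a => eC a, fun t => (Q.equivFin.symm t).1, matrixSupport M',
    ?_, hr1.trans hrQ, hrQ, ?_, ?_, ?_, ?_⟩
  · refine matrixSupport_mem_skeletonPatterns M' rfl _ _ Q Q.equivFin.symm ?_ ?_ ?_ ?_
    · intro i
      rw [span_range_equivFin (fun i => M' i) B eB]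
      exact hBsp i
    · intro j
      rw [span_range_equivFin (fun i => M'.transpose i) C eC]
      exact hCsp j
    · exact fun a j h => (hmemQ _ _).2 ⟨h, Or.inl (eB a).2⟩
    · exact fun i a h => (hmemQ _ _).2 ⟨h, Or.inr (eC a).2⟩
  · rw [← hBr]
    simpa using B.card_le_univ
  · simpa using Q.card_le_univ
  · refine Nat.le_of_mul_le_mul_left ?_ hAne.card_pos
    calc A.card * (n * Q.card) = n * (A.card * Q.card) := by ring
      _ ≤ n * (2 * (r * S)) := Nat.mul_le_mul_left _ hcardQ
      _ = 2 * S * (r * n) := by ring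
      _ ≤ 2 * S * (2 * s * A.card) := Nat.mul_le_mul_left _ hrn
      _ = A.card * (4 * s * S) := by ring
  · intro z hz h
    have := mem_matrixSupport.1 hz
    simp [hM', principalPart, h] at this

/-! ### Integer relations with bounded coefficients -/

/-- The left side bounds an r × r determinant with entries at most τ; the right side makes the bound
uniform in r. -/
theorem factorial_mul_pow_le {r s τ : ℕ} (hrs : r ≤ s) (hτ : 1 ≤ τ) :
    r.factorial * τ ^ r ≤ (s * τ) ^ s := by
  rcases Nat.eq_zero_or_pos s with rfl | hs
  · obtain rfl := Nat.le_zero.1 hrs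
    simp
  calc r.factorial * τ ^ r ≤ s ^ r * τ ^ r :=
        Nat.mul_le_mul_right _ ((Nat.factorial_le_pow r).trans (Nat.pow_le_pow_left hrs r))
    _ = (s * τ) ^ r := (mul_pow _ _ _).symm
    _ ≤ (s * τ) ^ s := Nat.pow_le_pow_right (Nat.mul_pos hs hτ) hrs

/-- Linearly independent columns of a matrix have a nonsingular square submatrix. -/
theorem exists_rows_det_ne_zero {s r : ℕ} (A : Matrix (Fin s) (Fin r) ℚ)
    (hA : LinearIndependent ℚ A.transpose.row) :
    ∃ ρ : Fin r → Fin s, (A.submatrix ρ id).det ≠ 0 := by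
  have hrank : A.rank = r := by
    rw [← Matrix.rank_transpose, Matrix.rank_eq_finrank_span_row,
      finrank_span_eq_card hA, Fintype.card_fin]
  obtain ⟨B, -, -, hsp, hli⟩ := exists_linearIndepOn_extension (K := ℚ) (v := A.row)
    (linearIndepOn_empty ℚ A.row) (Set.empty_subset Set.univ)
  lift B to Finset (Fin s) using Set.toFinite B
  have hcard : B.card = r := by
    rw [← finrank_span_image_eq_card hli]
    refine Eq.trans ?_ hrank
    rw [Matrix.rank_eq_finrank_span_row, ← Set.image_univ]
    rw [le_antisymm (Submodule.span_mono (Set.image_mono (Set.subset_univ (B : Set (Fin s)))))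
      (Submodule.span_le.2 hsp)]
  let e : Fin r ≃ B := (B.equivFinOfCardEq hcard).symm
  refine ⟨fun a => e a, ?_⟩
  have : LinearIndependent ℚ (A.submatrix (fun a => (e a : Fin s)) id).row :=
    LinearIndependent.comp hli e e.injective
  exact ((Matrix.isUnit_iff_isUnit_det _).1
    (Matrix.linearIndependent_rows_iff_isUnit.1 this)).ne_zero

/-- An integer vector in the rational span of integer vectors satisfies an integer relation with
bounded coefficients. -/
theorem exists_int_relation {ι : Type*} [Fintype ι] {s τ : ℕ} (t : ι → Fin s → ℤ)
    (hτ1 : 1 ≤ τ) (hτ : ∀ j a, |t j a| ≤ τ) (N : Finset ι) (i : ι)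
    (h : (fun a => (t i a : ℚ)) ∈
      Submodule.span ℚ ((fun j a => (t j a : ℚ)) '' (N : Set ι))) :
    ∃ (d : ℤ) (z : ι → ℤ), d ≠ 0 ∧ |d| ≤ ((s * τ) ^ s : ℕ) ∧ (∀ j, j ∉ N → z j = 0) ∧
      ∑ j, |z j| ≤ (s * (s * τ) ^ s : ℕ) ∧ ∀ a, d * t i a = ∑ j, z j * t j a := by
  classical
  obtain ⟨J, hJN, -, hsp, hli⟩ := exists_linearIndepOn_extension (K := ℚ)
    (v := fun j a => (t j a : ℚ)) (linearIndepOn_empty ℚ _) (Set.empty_subset (N : Set ι))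
  lift J to Finset ι using (Finset.finite_toSet N).subset hJN
  replace h := Submodule.span_le.2 hsp h
  set r := J.card with hr
  let e : Fin r ≃ J := J.equivFin.symm
  let A : Matrix (Fin s) (Fin r) ℤ := Matrix.of fun a j => t (e j) a
  have hAli : LinearIndependent ℚ (A.map (Int.castRingHom ℚ)).transpose.row :=
    LinearIndependent.comp hli e e.injective
  obtain ⟨ρ, hρ⟩ := exists_rows_det_ne_zero _ hAli
  have hrs : r ≤ s := by simpa using hAli.fintype_card_le_finrank
  set A₀ := A.submatrix ρ id with hA₀
  set v₀ : Fin r → ℤ := fun a => t i (ρ a) with hv₀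
  have hdetQ : ((A.map (Int.castRingHom ℚ)).submatrix ρ id).det = (A₀.det : ℚ) :=
    ((Int.castRingHom ℚ).map_det A₀).symm
  have hbound : ∀ X : Matrix (Fin r) (Fin r) ℤ, (∀ a b, |X a b| ≤ τ) →
      |X.det| ≤ ((s * τ) ^ s : ℕ) := by
    intro X hX
    have h1 := Matrix.det_le (abv := AbsoluteValue.abs) (x := (τ : ℤ)) hX
    rw [Fintype.card_fin, AbsoluteValue.abs_apply, nsmul_eq_mul] at h1
    refine h1.trans ?_
    exact_mod_cast factorial_mul_pow_le hrs hτ1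
  have hrange : ((fun j a => (t j a : ℚ)) '' (J : Set ι)) =
      Set.range fun b : Fin r => fun a => (t (e b) a : ℚ) := by
    ext x
    constructor
    · rintro ⟨j, hj, rfl⟩
      exact ⟨e.symm ⟨j, hj⟩, by simp⟩
    · rintro ⟨b, rfl⟩
      exact ⟨e b, (e b).2, rfl⟩
  rw [hrange, Submodule.mem_span_range_iff_exists_fun] at h
  obtain ⟨c, hc⟩ := h
  have hc' : ∀ a, ∑ b, c b * (t (e b) a : ℚ) = t i a := fun a => by
    simpa using congrFun hc a
  have hcramer : ∀ b, ((A₀.cramer v₀ b : ℤ) : ℚ) = A₀.det * c b := by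
    have h1 : (A₀.map (Int.castRingHom ℚ)).mulVec c = fun a => (v₀ a : ℚ) := by
      ext a
      rw [hv₀, ← hc' (ρ a), Matrix.mulVec, dotProduct]
      exact Finset.sum_congr rfl fun b _ => mul_comm _ _
    have h2 : (A₀.map (Int.castRingHom ℚ)).adjugate.mulVec (fun a => (v₀ a : ℚ)) =
        (A₀.map (Int.castRingHom ℚ)).det • c := by
      rw [← h1, Matrix.mulVec_mulVec, Matrix.adjugate_mul, Matrix.smul_mulVec, Matrix.one_mulVec]
    intro b
    have h3 := congrFun h2 b
    rw [Pi.smul_apply, smul_eq_mul] at h3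
    rw [Matrix.cramer_eq_adjugate_mulVec, ← show (A₀.map (Int.castRingHom ℚ)).det = (A₀.det : ℚ) from
      ((Int.castRingHom ℚ).map_det A₀).symm, ← h3, ← show A₀.adjugate.map (Int.castRingHom ℚ) =
      (A₀.map (Int.castRingHom ℚ)).adjugate from (Int.castRingHom ℚ).map_adjugate A₀]
    simp [Matrix.mulVec, dotProduct]
  have hsum : ∀ {R : Type} [AddCommMonoid R] (f : ι → R), (∀ j, j ∉ J → f j = 0) →
      ∑ j, f j = ∑ b, f (e b) := by
    intro R _ f hf
    rw [← Finset.sum_subset (Finset.subset_univ J) fun j _ hj => hf j hj, ← Finset.sum_coe_sort]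
    exact (Equiv.sum_comp e fun j : J => f j).symm
  -- Cramer's rule on a nonsingular r × r minor of an independent subfamily J: the common
  -- denominator d and the numerators z_j are determinants of size r ≤ s. Rows outside the minor
  -- need no check, since the rational relation holds in all rows.
  refine ⟨A₀.det, fun j => if hj : j ∈ J then A₀.cramer v₀ (e.symm ⟨j, hj⟩) else 0, ?_, ?_, ?_, ?_, ?_⟩
  · rw [hdetQ] at hρ
    exact_mod_cast hρ
  · exact hbound _ fun a b => hτ _ _
  · intro j hj
    exact dif_neg fun h => hj (hJN h)
  · rw [hsum _ fun j hj => by simp [hj]]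
    calc _ ≤ ∑ _b : Fin r, (((s * τ) ^ s : ℕ) : ℤ) := by
          refine Finset.sum_le_sum fun b _ => ?_
          simp only [Subtype.coe_eta, Equiv.symm_apply_apply, (e b).2, dif_pos]
          rw [Matrix.cramer_apply]
          refine hbound _ fun a b' => ?_
          rw [Matrix.updateCol_apply]
          split_ifs
          · exact hτ _ _
          · exact hτ _ _
      _ = r * (((s * τ) ^ s : ℕ) : ℤ) := by simp
      _ ≤ _ := by
        rw [Nat.cast_mul]
        exact mul_le_mul_of_nonneg_right (by exact_mod_cast hrs) (by positivity)
  · intro a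
    rw [hsum _ fun j hj => by simp [hj]]
    simp only [Subtype.coe_eta, Equiv.symm_apply_apply, Finset.coe_mem, dif_pos]
    have : ((A₀.det * t i a : ℤ) : ℚ) = ((∑ b, A₀.cramer v₀ b * t (e b) a : ℤ) : ℚ) := by
      rw [Int.cast_mul, ← hc' a, Finset.mul_sum, Int.cast_sum]
      exact Finset.sum_congr rfl fun b _ => by rw [Int.cast_mul, hcramer]; ring
    exact_mod_cast this

/-! ### Hard inputs with equal sketches -/

/-- A union bound in product form: the coordinates fail to stay in the box with total probability at
most the sum. -/
theorem one_sub_sum_le_prod {ι : Type*} (A : Finset ι) (a : ι → ℝ) (h0 : ∀ i ∈ A, 0 ≤ a i)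
    (h1 : ∀ i ∈ A, a i ≤ 1) : 1 - ∑ i ∈ A, (1 - a i) ≤ ∏ i ∈ A, a i := by
  classical
  induction A using Finset.induction_on with
  | empty => simp
  | insert i A hi ih =>
    rw [Finset.sum_insert hi, Finset.prod_insert hi]
    have hp : ∏ j ∈ A, a j ≤ 1 := Finset.prod_le_one
      (fun j hj => h0 j (Finset.mem_insert_of_mem hj))
      fun j hj => h1 j (Finset.mem_insert_of_mem hj)
    have h2 := ih (fun j hj => h0 j (Finset.mem_insert_of_mem hj))
      fun j hj => h1 j (Finset.mem_insert_of_mem hj)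
    nlinarith [h0 i (Finset.mem_insert_self _ _), h1 i (Finset.mem_insert_self _ _)]

/-- Most points of a large box stay in the box after a translation by a short vector. -/
theorem card_box_shift {n R : ℕ} (hR : 0 < R) (z : Fin n → ℤ) (hz : 4 * ∑ j, |z j| ≤ R) :
    3 * R ^ n ≤ 4 * ((Fintype.piFinset fun _ : Fin n => Finset.Icc 1 R).filter fun y =>
      ∀ j, 1 ≤ (y j : ℤ) + z j ∧ (y j : ℤ) + z j ≤ R).card := by
  have hset : ((Fintype.piFinset fun _ : Fin n => Finset.Icc 1 R).filter fun y =>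
      ∀ j, 1 ≤ (y j : ℤ) + z j ∧ (y j : ℤ) + z j ≤ R) =
      Fintype.piFinset fun j => (Finset.Icc 1 R).filter fun y : ℕ =>
        1 ≤ (y : ℤ) + z j ∧ (y : ℤ) + z j ≤ R := by
    ext y
    simp [Fintype.mem_piFinset, forall_and]
  rw [hset, Fintype.card_piFinset]
  set c : Fin n → ℕ := fun j => ((Finset.Icc 1 R).filter fun y : ℕ =>
        1 ≤ (y : ℤ) + z j ∧ (y : ℤ) + z j ≤ R).card with hc
  have hle : ∀ j, c j ≤ R := fun j => (Finset.card_filter_le _ _).trans (by simp)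
  have hge : ∀ j, (R : ℤ) - |z j| ≤ c j := by
    intro j
    have hsub : (Finset.Icc (1 + (-z j).toNat) (R - (z j).toNat)) ⊆
        (Finset.Icc 1 R).filter fun y : ℕ => 1 ≤ (y : ℤ) + z j ∧ (y : ℤ) + z j ≤ R := by
      intro y hy
      simp only [Finset.mem_Icc, Finset.mem_filter] at hy ⊢
      omega
    have : _ ≤ c j := Finset.card_le_card hsub
    rw [Nat.card_Icc] at this
    rcases abs_cases (z j) with h | h <;> omega
  have hRR : (0 : ℝ) < R := by exact_mod_cast hR
  have h1 := one_sub_sum_le_prod Finset.univ (fun j => (c j : ℝ) / R) (fun j _ => by positivity)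
    fun j _ => by rw [div_le_one hRR]; exact_mod_cast hle j
  have h2 : ∑ j, (1 - (c j : ℝ) / R) ≤ 1 / 4 := by
    calc ∑ j, (1 - (c j : ℝ) / R) ≤ ∑ j, (|z j| : ℝ) / R := by
          refine Finset.sum_le_sum fun j _ => ?_
          rw [sub_le_iff_le_add, ← add_div, le_div_iff₀ hRR, one_mul]
          have := hge j
          have h3 : ((R : ℤ) : ℝ) ≤ ((|z j| + c j : ℤ) : ℝ) := by exact_mod_cast (by linarith)
          push_cast at h3
          exact h3
      _ = (∑ j, (|z j| : ℝ)) / R := by rw [Finset.sum_div]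
      _ ≤ 1 / 4 := by
        rw [div_le_div_iff₀ hRR (by norm_num)]
        have h3 : (((4 * ∑ j, |z j| : ℤ)) : ℝ) ≤ ((R : ℤ) : ℝ) := by exact_mod_cast hz
        push_cast at h3
        linarith
  rw [Finset.prod_div_distrib, Finset.prod_const, Finset.card_univ, Fintype.card_fin] at h1
  have h3 : (3 / 4 : ℝ) ≤ (∏ j, (c j : ℝ)) / (R : ℝ) ^ n := by linarith
  rw [div_le_div_iff₀ (by norm_num) (by positivity)] at h3
  have h4 : (3 * R ^ n : ℝ) ≤ 4 * ∏ j, (c j : ℝ) := by linarith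
  exact_mod_cast h4

theorem hardInput_nonneg {n : ℕ} (E : Fin n × Fin n → Bool) (P : ℕ) (i : Fin n) (b : Bool)
    (y : Fin n → ℕ) (a : BipVertex n) : 0 ≤ hardInput E P i b y a := by
  rcases a with j | j
  · simp only [hardInput]
    split_ifs <;> positivity
  · simp [hardInput]

theorem graphDist_comm {n : ℕ} (E : Fin n × Fin n → Bool) (a b : BipVertex n) :
    graphDist E a b = graphDist E b a := by
  rw [graphDist, graphDist, SimpleGraph.edist_comm]

theorem graphDist_le_one {n : ℕ} {E : Fin n × Fin n → Bool} {j i : Fin n}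
    (h : E (j, i) = true) : graphDist E (Sum.inr i) (Sum.inl j) ≤ 1 := by
  have hadj : (bipGraph E).Adj (Sum.inr i) (Sum.inl j) := h
  rw [graphDist, SimpleGraph.edist_eq_one_iff_adj.2 hadj]
  simp

theorem mem_farIndices {n k : ℕ} {E : Fin n × Fin n → Bool} {i : Fin n} :
    i ∈ farIndices k E ↔
      ((2 * k + 1 : ℕ) : ℝ≥0∞) ≤ graphDist E (Sum.inl i) (Sum.inr i) := by
  simp [farIndices]

/-- Ensures that u_i, which carries the hidden bit, is not also a neighbor of v_i. -/
theorem edge_eq_false_of_mem_farIndices {n k : ℕ} {E : Fin n × Fin n → Bool} {i : Fin n}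
    (hk : 1 ≤ k) (hi : i ∈ farIndices k E) : E (i, i) = false := by
  by_contra h
  rw [Bool.not_eq_false] at h
  have h1 := (mem_farIndices.1 hi).trans ((graphDist_comm E _ _).trans_le (graphDist_le_one h))
  have h2 : 2 * k + 1 ≤ 1 := by exact_mod_cast h1
  omega

theorem afn_hardInput_true {n k : ℕ} {c : ℝ} {E : Fin n × Fin n → Bool} {P : ℕ} {i : Fin n}
    (hP : 0 < P) (hc : c ≤ 2 * (k : ℝ) + 1) (hi : i ∈ farIndices k E) (y : Fin n → ℕ) :
    afn (graphDist E) 1 c (hardInput E P i true y) (Sum.inr i) = some true := by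
  refine if_pos ⟨hardInput_nonneg E P i true y, ?_⟩
  have h1 : ENNReal.ofReal (c * 1) ≤ ((2 * k + 1 : ℕ) : ℝ≥0∞) := by
    rw [mul_one]
    refine ENNReal.ofReal_le_of_le_toReal ?_
    rw [ENNReal.toReal_natCast]
    push_cast
    exact hc
  refine (h1.trans (mem_farIndices.1 hi)).trans ?_
  rw [graphDist_comm]
  refine le_iSup₂_of_le (Sum.inl i) ?_ le_rfl
  simpa [hardInput] using hP

theorem afn_hardInput_false {n : ℕ} {c : ℝ} {E : Fin n × Fin n → Bool} {P : ℕ} {i : Fin n}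
    (hc : 1 < c) (y : Fin n → ℕ) :
    afn (graphDist E) 1 c (hardInput E P i false y) (Sum.inr i) = some false := by
  have hle : furthestDist (graphDist E) (hardInput E P i false y) (Sum.inr i) ≤ 1 := by
    refine iSup₂_le fun a ha => ?_
    rcases a with j | j
    · by_cases h : E (j, i) = true
      · exact graphDist_le_one h
      · simp [hardInput, h] at ha
    · simp [hardInput] at ha
  rw [afn, if_neg, if_pos]
  · exact ⟨hardInput_nonneg E P i false y, by simpa using hle⟩
  · rintro ⟨-, h⟩
    have h1 : ENNReal.ofReal (c * 1) ≤ ENNReal.ofReal 1 := by simpa using h.trans hle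
    rw [ENNReal.ofReal_le_ofReal_iff zero_le_one] at h1
    linarith

/-- Two hard inputs with different bits and the same sketch: the sketch errs on one of them. -/
theorem mem_sketchErrors_or {n k s : ℕ} {c : ℝ} {E : Fin n × Fin n → Bool} {P : ℕ} {i : Fin n}
    (hP : 0 < P) (hc1 : 1 < c) (hc : c ≤ 2 * (k : ℝ) + 1) (hi : i ∈ farIndices k E)
    (T : Matrix (Fin s) (BipVertex n) ℤ) (Dec : (Fin s → ℤ) → BipVertex n → Bool)
    (y y' : Fin n → ℕ)
    (h : T.mulVec (hardInput E P i true y) = T.mulVec (hardInput E P i false y')) :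
    hardInput E P i true y ∈ sketchErrors E c T Dec ∨
      hardInput E P i false y' ∈ sketchErrors E c T Dec := by
  cases hD : Dec (T.mulVec (hardInput E P i true y)) (Sum.inr i) with
  | true =>
    refine Or.inr ⟨Sum.inr i, false, afn_hardInput_false hc1 y', ?_⟩
    rw [← h, hD]
    decide
  | false =>
    refine Or.inl ⟨Sum.inr i, true, afn_hardInput_true hP hc hi y, ?_⟩
    rw [hD]
    decide

/-- The sketch of a hard input, when the column of the hidden index is a combination of the columns
of the neighbors, does not determine the bit. -/
theorem mulVec_hardInput_eq {n s : ℕ} {E : Fin n × Fin n → Bool} {P : ℕ} {i : Fin n}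
    (T : Matrix (Fin s) (BipVertex n) ℤ) (hii : E (i, i) = false) (z : Fin n → ℤ)
    (hz : ∀ j, E (j, i) = false → z j = 0)
    (hTz : ∀ a, (P : ℤ) * T a (Sum.inl i) = ∑ j, z j * T a (Sum.inl j)) (y y' : Fin n → ℕ)
    (hy : ∀ j, (y' j : ℤ) = y j + z j) :
    T.mulVec (hardInput E P i true y) = T.mulVec (hardInput E P i false y') := by
  ext a
  rw [Matrix.mulVec, Matrix.mulVec, dotProduct, dotProduct, Fintype.sum_sum_type,
    Fintype.sum_sum_type]
  have h1 : ∀ j, T a (Sum.inl j) * hardInput E P i true y (Sum.inl j) =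
      T a (Sum.inl j) * hardInput E P i false y' (Sum.inl j) +
        ((if j = i then (P : ℤ) * T a (Sum.inl i) else 0) - z j * T a (Sum.inl j)) := by
    intro j
    by_cases hji : j = i
    · subst hji
      simp [hardInput, hz _ hii, mul_comm]
    · by_cases hE : E (j, i) = true
      · simp only [hardInput, if_neg hji, if_pos hE, hy]
        ring
      · simp [hardInput, hji, hE, hz j (by simpa using hE)]
  simp_rw [h1]
  rw [Finset.sum_add_distrib, Finset.sum_sub_distrib, Finset.sum_ite_eq' Finset.univ i, ← hTz]
  simp [hardInput]

theorem hardDist_real {n k : ℕ} {E : Fin n × Fin n → Bool} {P U : ℕ}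
    (hI : (farIndices k E).Nonempty) (hP : 0 < P) (hU : 0 < U) (S : Set (BipVertex n → ℤ))
    [DecidablePred fun t : Fin n × Bool × (Fin n → ℕ) => hardInput E P t.1 t.2.1 t.2.2 ∈ S] :
    (hardDist k E P U hI hP hU).toMeasure.real S =
      (((hardChoices k E P U).filter fun t => hardInput E P t.1 t.2.1 t.2.2 ∈ S).card : ℝ) /
        (hardChoices k E P U).card := by
  classical
  rw [Measure.real, PMF.toMeasure_apply_eq_toOuterMeasure, hardDist, PMF.toOuterMeasure_map_apply,
    PMF.toOuterMeasure_uniformOfFinset_apply, ENNReal.toReal_div, ENNReal.toReal_natCast,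
    ENNReal.toReal_natCast]
  congr

/-- The error probability is large when many pairs of hard inputs with the same hidden index and
different bits have the same sketch. -/
theorem three_le_error {n k s : ℕ} {c : ℝ} {E : Fin n × Fin n → Bool} {P U : ℕ}
    (hI : (farIndices k E).Nonempty) (hP : 0 < P) (hU : 0 < U) (hn : 0 < n) (hk : 1 ≤ k)
    (hc1 : 1 < c) (hc : c ≤ 2 * (k : ℝ) + 1) (T : Matrix (Fin s) (BipVertex n) ℤ)
    (Dec : (Fin s → ℤ) → BipVertex n → Bool) {i : Fin n} (hi : i ∈ farIndices k E)
    (z : Fin n → ℤ) (hz : ∀ j, E (j, i) = false → z j = 0)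
    (hTz : ∀ a, (P : ℤ) * T a (Sum.inl i) = ∑ j, z j * T a (Sum.inl j))
    (hzU : 4 * ∑ j, |z j| ≤ (P * U : ℕ)) :
    3 / (8 * (n : ℝ)) ≤ (hardDist k E P U hI hP hU).toMeasure.real (sketchErrors E c T Dec) := by
  classical
  set R := P * U with hR
  have hRpos : 0 < R := Nat.mul_pos hP hU
  set X := Fintype.piFinset fun _ : Fin n => Finset.Icc 1 R with hX
  set S := sketchErrors E c T Dec with hS
  set Y := X.filter fun y => ∀ j, 1 ≤ (y j : ℤ) + z j ∧ (y j : ℤ) + z j ≤ R with hY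
  have hYcard : 3 * R ^ n ≤ 4 * Y.card := card_box_shift hRpos z hzU
  set err := (hardChoices k E P U).filter fun t => hardInput E P t.1 t.2.1 t.2.2 ∈ S with herr
  have hcardY : Y.card ≤ err.card := by
    -- Each y in Y pays for one error: the input with bit 1 and values y, or else its partner with
    -- bit 0 and values y + z. The bit tells the two cases apart and the translation is injective.
    refine Finset.card_le_card_of_injOn (fun y => if hardInput E P i true y ∈ S then (i, true, y)
      else (i, false, fun j => ((y j : ℤ) + z j).toNat)) ?_ ?_
    · intro y hy
      obtain ⟨hyX, hyz⟩ := Finset.mem_filter.1 hy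
      rw [hX, Fintype.mem_piFinset] at hyX
      simp only
      split_ifs with h
      · refine Finset.mem_filter.2 ⟨?_, h⟩
        simp only [hardChoices, Finset.mem_product, Finset.mem_univ, true_and, Fintype.mem_piFinset]
        exact ⟨hi, hyX⟩
      · have hy' : ∀ j, ((((y j : ℤ) + z j).toNat : ℕ) : ℤ) = y j + z j := fun j =>
          Int.toNat_of_nonneg (by linarith [(hyz j).1])
        refine Finset.mem_filter.2 ⟨?_, ?_⟩
        · simp only [hardChoices, Finset.mem_product, Finset.mem_univ, true_and,
            Fintype.mem_piFinset, Finset.mem_Icc]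
          refine ⟨hi, fun j => ?_⟩
          have h1 := hy' j
          have h2 := hyz j
          rw [← hR]
          omega
        · exact (mem_sketchErrors_or hP hc1 hc hi T Dec y _ (mulVec_hardInput_eq T
            (edge_eq_false_of_mem_farIndices hk hi) z hz hTz y _ hy')).resolve_left h
    · intro y hy y' hy' h
      have h1 := (Finset.mem_filter.1 hy).2
      have h2 := (Finset.mem_filter.1 hy').2
      simp only at h
      split_ifs at h
      · simpa using h
      · simp at h
      · simp at h
      · have h3 := congrArg (fun t => t.2.2) h
        funext j
        have h4 := congrFun h3 j
        simp only at h4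
        have h5 := h1 j
        have h6 := h2 j
        omega
  -- At most n hidden indices and two bits, so the error is at least (3/4) R^n / (2n R^n) = 3/(8n).
  have hcard : (hardChoices k E P U).card ≤ n * (2 * R ^ n) := by
    rw [hardChoices, Finset.card_product, Finset.card_product, Finset.card_univ, Fintype.card_bool,
      Fintype.card_piFinset_const, Nat.card_Icc, Nat.add_sub_cancel]
    exact Nat.mul_le_mul_right _ (by simpa using (farIndices k E).card_le_univ)
  have hpos : 0 < (hardChoices k E P U).card := (hardChoices_nonempty hI hP hU).card_pos
  rw [hardDist_real, div_le_div_iff₀ (by positivity) (by positivity)]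
  have h1 : 3 * (hardChoices k E P U).card ≤ err.card * (8 * n) := by
    calc 3 * (hardChoices k E P U).card ≤ 3 * (n * (2 * R ^ n)) := Nat.mul_le_mul_left _ hcard
      _ = 2 * n * (3 * R ^ n) := by ring
      _ ≤ 2 * n * (4 * Y.card) := Nat.mul_le_mul_left _ hYcard
      _ = Y.card * (8 * n) := by ring
      _ ≤ err.card * (8 * n) := Nat.mul_le_mul_right _ hcardY
  exact_mod_cast h1

/-- A sketch that is wrong only with small probability separates the column of every far index from
the columns of its neighbors. -/
theorem notMem_span_of_error_le {n k s M U : ℕ} {c : ℝ} {E : Fin n × Fin n → Bool}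
    (hI : (farIndices k E).Nonempty) (hU : 0 < U) (hn : 0 < n) (hk : 1 ≤ k)
    (hc1 : 1 < c) (hc : c ≤ 2 * (k : ℝ) + 1)
    (hM : (s ^ 2 * (2 * n) ^ (2 * n)) ^ s ≤ M)
    (hMU : n * (s ^ 2 * (2 * n) ^ (2 * n)) ^ (s + 1) ≤ U)
    (T : Matrix (Fin s) (BipVertex n) ℤ) (Dec : (Fin s → ℤ) → BipVertex n → Bool)
    (hT : ∀ a b, |T a b| ≤ ((2 * n) ^ (2 * n) : ℕ))
    (herr : (hardDist k E M.factorial U hI (Nat.factorial_pos M) hU).toMeasure.real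
      (sketchErrors E c T Dec) ≤ 1 / (200 * (n : ℝ))) {i : Fin n} (hi : i ∈ farIndices k E) :
    (fun a => (T a (Sum.inl i) : ℚ)) ∉ Submodule.span ℚ
      ((fun j a => (T a (Sum.inl j) : ℚ)) ''
        ((Finset.univ.filter fun j => E (j, i) = true : Finset (Fin n)) : Set (Fin n))) := by
  intro h
  set τ := (2 * n) ^ (2 * n) with hτ
  have hτ1 : 1 ≤ τ := Nat.one_le_pow _ _ (by omega)
  obtain ⟨d, z, hd0, hdle, hzN, hzsum, hrel⟩ :=
    exists_int_relation (fun j a => T a (Sum.inl j)) hτ1 (fun j a => hT a _) _ i h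
  have hLB : (s * τ) ^ s ≤ (s ^ 2 * τ) ^ s :=
    Nat.pow_le_pow_left (Nat.mul_le_mul_right _ (Nat.le_self_pow two_ne_zero s)) s
  -- The reason for taking P = M!: every nonzero d with |d| ≤ M divides it, whichever relation T
  -- satisfies.
  have hdvd : d ∣ (M.factorial : ℤ) := by
    rw [← Int.natAbs_dvd, Int.natCast_dvd_natCast]
    refine Nat.dvd_factorial (Int.natAbs_pos.2 hd0) ?_
    have : d.natAbs ≤ (s * τ) ^ s := by
      rw [Int.abs_eq_natAbs] at hdle
      exact_mod_cast hdle
    exact this.trans (hLB.trans hM)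
  obtain ⟨m, hm⟩ := hdvd
  have hmle : |m| ≤ M.factorial := by
    rw [← Int.natCast_natAbs, Nat.cast_le]
    refine Nat.le_of_dvd (Nat.factorial_pos M) ?_
    rw [← Int.natCast_dvd_natCast, Int.natAbs_dvd]
    exact ⟨d, by rw [hm, mul_comm]⟩
  have hsU : 4 * (s * (s * τ) ^ s) ≤ U := by
    rcases Nat.eq_zero_or_pos s with rfl | hs
    · simp
    refine le_trans ?_ hMU
    have h4 : 4 * s ≤ n * (s ^ 2 * τ) := by
      have h1 : 4 ≤ τ := by
        calc 4 = 2 ^ 2 := by norm_num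
          _ ≤ (2 * n) ^ 2 := Nat.pow_le_pow_left (by omega) 2
          _ ≤ τ := Nat.pow_le_pow_right (by omega) (by omega)
      calc 4 * s ≤ τ * s ^ 2 := Nat.mul_le_mul h1 (Nat.le_self_pow two_ne_zero s)
        _ = 1 * (s ^ 2 * τ) := by ring
        _ ≤ _ := Nat.mul_le_mul_right _ hn
    calc 4 * (s * (s * τ) ^ s) = 4 * s * (s * τ) ^ s := by ring
      _ ≤ n * (s ^ 2 * τ) * (s ^ 2 * τ) ^ s := Nat.mul_le_mul h4 hLB
      _ = _ := by ring
  -- With P = d m, multiplying the relation by m gives the translation m z. Since |m| ≤ P, its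
  -- length is at most a quarter of the side P U of the box.
  have hbig := three_le_error hI (Nat.factorial_pos M) hU hn hk hc1 hc T Dec hi (fun j => m * z j)
    (fun j hj => by
      rw [hzN j (by simp [hj]), mul_zero])
    (fun a => by
      rw [hm, mul_comm d m, mul_assoc, hrel a, Finset.mul_sum]
      exact Finset.sum_congr rfl fun j _ => by ring)
    (by
      simp_rw [abs_mul]
      rw [← Finset.mul_sum]
      calc 4 * (|m| * ∑ j, |z j|) ≤ 4 * ((M.factorial : ℤ) * (s * (s * τ) ^ s : ℕ)) := by
            gcongr
        _ = ((M.factorial * (4 * (s * (s * τ) ^ s)) : ℕ) : ℤ) := by push_cast; ring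
        _ ≤ ((M.factorial * U : ℕ) : ℤ) := by exact_mod_cast Nat.mul_le_mul_left _ hsU)
  have hn' : (0 : ℝ) < n := by exact_mod_cast hn
  have := hbig.trans herr
  rw [div_le_div_iff₀ (by positivity) (by positivity)] at this
  nlinarith

/-! ### From a sketch to a matrix of small rank -/

/-- Such a sketch yields a matrix of small rank that vanishes on the edges and not on the far
diagonal positions. -/
theorem exists_matrix_of_notMem_span {n s : ℕ} (I : Finset (Fin n)) (E : Fin n × Fin n → Bool)
    (t : Fin n → Fin s → ℚ)
    (h : ∀ i ∈ I, t i ∉ Submodule.span ℚ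
      (t '' ((Finset.univ.filter fun j => E (j, i) = true : Finset (Fin n)) : Set (Fin n)))) :
    ∃ M : Matrix (Fin n) (Fin n) ℚ, M.rank ≤ s ∧ (∀ i ∈ I, M i i ≠ 0) ∧
      ∀ i j, M i j ≠ 0 → E (j, i) = false := by
  classical
  have hex : ∀ i, ∃ f : (Fin s → ℚ) →ₗ[ℚ] ℚ, (i ∈ I → f (t i) ≠ 0) ∧
      ∀ j, E (j, i) = true → f (t j) = 0 := by
    intro i
    by_cases hi : i ∈ I
    · obtain ⟨f, hf, hker⟩ := Submodule.exists_le_ker_of_notMem (h i hi)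
      exact ⟨f, fun _ => hf, fun j hj => hker (Submodule.subset_span ⟨j, by simpa using hj, rfl⟩)⟩
    · exact ⟨0, fun h => absurd h hi, fun _ _ => rfl⟩
  choose f hf1 hf2 using hex
  refine ⟨Matrix.of fun i j => f i (t j), ?_, fun i hi => hf1 i hi, fun i j hij => ?_⟩
  · have : (Matrix.of fun i j => f i (t j)) =
        (Matrix.of fun i a => f i (Pi.single a 1) : Matrix (Fin n) (Fin s) ℚ) *
          (Matrix.of t).transpose := by
      ext i j
      rw [Matrix.mul_apply, Matrix.of_apply]
      conv_lhs => rw [pi_eq_sum_univ' (t j), map_sum]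
      refine Finset.sum_congr rfl fun a _ => ?_
      rw [map_smul, smul_eq_mul, mul_comm]
      rfl
    rw [this]
    refine (Matrix.rank_mul_le_left _ _).trans ?_
    simpa using Matrix.rank_le_card_width
      (Matrix.of fun i a => f i (Pi.single a 1) : Matrix (Fin n) (Fin s) ℚ)
  · by_contra hE
    exact hij (hf2 i j (by simpa using hE))

/-! ### Union bound over skeleton patterns in the random graph -/

instance {n : ℕ} (p : unitInterval) : IsProbabilityMeasure (randomBipartite n p) := by
  unfold randomBipartite
  infer_instance

theorem randomBipartite_cylinder {n : ℕ} (p : unitInterval) (Z : Finset (Fin n × Fin n))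
    (v : Bool) : (randomBipartite n p).real {E | ∀ z ∈ Z, E z = v} =
      (if v then (p : ℝ) else 1 - p) ^ Z.card := by
  classical
  have hset : {E : Fin n × Fin n → Bool | ∀ z ∈ Z, E z = v} =
      Set.univ.pi fun z => if z ∈ Z then {v} else Set.univ := by
    ext E
    simp only [Set.mem_ofPred_eq, Set.mem_univ_pi]
    refine forall_congr' fun z => ?_
    split_ifs with h <;> simp [h]
  have hv : (ProbabilityTheory.bernoulliMeasure true false p).real {v} =
      if v then (p : ℝ) else 1 - p := by
    rw [ProbabilityTheory.bernoulliMeasure_real_apply p (MeasurableSet.singleton v)]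
    cases v <;> simp
  rw [hset, Measure.real, randomBipartite, Measure.pi_pi, ENNReal.toReal_prod,
    ← Finset.prod_subset (Finset.subset_univ Z)]
  · rw [← hv, Finset.prod_congr rfl fun z hz => by rw [if_pos hz], Finset.prod_const]
    rfl
  · intro z _ hz
    rw [if_neg hz]
    simp

/-- The event that no edge of the graph meets a skeleton pattern with many positions in relation to
its number of variables. -/
def sparsePatternEvent (n : ℕ) (p : unitInterval) : Set (Fin n × Fin n → Bool) :=
  {E | ∃ (r q : ℕ) (b c : Fin r → Fin n) (g : Fin q → Fin n × Fin n) (Z : Finset (Fin n × Fin n)),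
    Z ∈ skeletonPatterns b c g ∧ 1 ≤ q ∧ r ≤ q ∧ r ≤ n ∧ q ≤ n * n ∧
    20 * q * Real.log n ≤ p * Z.card ∧ ∀ z ∈ Z, E z.swap = false}

theorem randomBipartite_avoid_le {n : ℕ} (hn : 1 ≤ n) (p : unitInterval) (q : ℕ)
    (Z : Finset (Fin n × Fin n)) (hZ : 20 * q * Real.log n ≤ p * Z.card) :
    (randomBipartite n p).real {E | ∀ z ∈ Z, E z.swap = false} ≤ ((n : ℝ) ^ (20 * q))⁻¹ := by
  classical
  have hset : {E : Fin n × Fin n → Bool | ∀ z ∈ Z, E z.swap = false} =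
      {E | ∀ z ∈ Z.image Prod.swap, E z = false} := by
    ext E
    simp only [Set.mem_ofPred_eq, Finset.forall_mem_image]
  rw [hset, randomBipartite_cylinder, Finset.card_image_of_injective _ Prod.swap_injective]
  have hn' : (0 : ℝ) < n := by exact_mod_cast hn
  have h1 : (1 - (p : ℝ)) ≤ Real.exp (-p) := by
    have := Real.add_one_le_exp (-(p : ℝ))
    linarith
  calc _ ≤ Real.exp (-p) ^ Z.card :=
        pow_le_pow_left₀ (by simpa using sub_nonneg.2 p.2.2) (by simpa using h1) _
    _ = Real.exp (-(p * Z.card)) := by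
      rw [← Real.exp_nat_mul]
      congr 1
      ring
    _ ≤ Real.exp (-(20 * q * Real.log n)) := Real.exp_le_exp.2 (neg_le_neg hZ)
    _ = _ := by
      rw [Real.exp_neg, ← Real.exp_log (pow_pos hn' (20 * q)), Real.log_pow]
      push_cast
      rfl

theorem randomBipartite_sparsePatternEvent_le {n : ℕ} (hn : 2 ≤ n) (p : unitInterval) :
    (randomBipartite n p).real (sparsePatternEvent n p) ≤ 2 / n := by
  classical
  have hn0 : (0 : ℝ) < n := by exact_mod_cast (by omega : 0 < n)
  have hn1 : (1 : ℝ) ≤ n := by exact_mod_cast (by omega : 1 ≤ n)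
  set μ := randomBipartite n p with hμ
  let ev (Z : Finset (Fin n × Fin n)) : Set (Fin n × Fin n → Bool) := {E | ∀ z ∈ Z, E z.swap = false}
  let W (r q : ℕ) (b c : Fin r → Fin n) (g : Fin q → Fin n × Fin n) :=
    (skeletonPatterns b c g).filter fun Z => 20 * q * Real.log n ≤ p * Z.card
  have hsub : sparsePatternEvent n p ⊆
      ⋃ r ∈ Finset.range (n + 1), ⋃ q ∈ Finset.Icc (max 1 r) (n * n),
        ⋃ b : Fin r → Fin n, ⋃ c : Fin r → Fin n, ⋃ g : Fin q → Fin n × Fin n,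
          ⋃ Z ∈ W r q b c g, ev Z := by
    rintro E ⟨r, q, b, c, g, Z, hZ, hq1, hrq, hrn, hqn, hlog, hE⟩
    simp only [Set.mem_iUnion, exists_prop]
    exact ⟨r, Finset.mem_range.2 (by omega), q, Finset.mem_Icc.2 ⟨by omega, hqn⟩, b, c, g, Z,
      Finset.mem_filter.2 ⟨hZ, hlog⟩, hE⟩
  have hterm : ∀ r ∈ Finset.range (n + 1), ∀ q ∈ Finset.Icc (max 1 r) (n * n),
      μ.real (⋃ b : Fin r → Fin n, ⋃ c : Fin r → Fin n, ⋃ g : Fin q → Fin n × Fin n,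
          ⋃ Z ∈ W r q b c g, ev Z) ≤ ((n : ℝ) ^ 4)⁻¹ := by
    intro r hr q hq
    rw [Finset.mem_range] at hr
    rw [Finset.mem_Icc] at hq
    have hq1 : 1 ≤ q := (le_max_left 1 r).trans hq.1
    have hrq : r ≤ q := (le_max_right 1 r).trans hq.1
    have hcount : (n * n * (r + 2) + 1) ^ q ≤ n ^ (5 * q) := by
      rw [pow_mul]
      refine Nat.pow_le_pow_left ?_ q
      have h2 : r + 2 ≤ 2 * n := by omega
      calc n * n * (r + 2) + 1 ≤ n * n * (2 * n) + n * n * n :=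
            add_le_add (Nat.mul_le_mul_left _ h2)
              (Nat.mul_pos (Nat.mul_pos (by omega) (by omega)) (by omega))
        _ = 3 * n ^ 3 := by ring
        _ ≤ n ^ 2 * n ^ 3 := Nat.mul_le_mul_right _ (by nlinarith)
        _ = n ^ 5 := by ring
    have hW : ∀ b c g, μ.real (⋃ Z ∈ W r q b c g, ev Z) ≤
        (n : ℝ) ^ (5 * q) * ((n : ℝ) ^ (20 * q))⁻¹ := by
      intro b c g
      refine (measureReal_biUnion_finset_le _ _).trans ?_
      refine (Finset.sum_le_card_nsmul _ _ _ fun Z hZ =>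
        randomBipartite_avoid_le (by omega) p q Z (Finset.mem_filter.1 hZ).2).trans ?_
      rw [nsmul_eq_mul]
      refine mul_le_mul_of_nonneg_right ?_ (by positivity)
      have : (W r q b c g).card ≤ n ^ (5 * q) :=
        ((Finset.card_filter_le _ _).trans (card_skeletonPatterns_le b c g)).trans hcount
      rw [← Nat.cast_pow, Nat.cast_le]
      exact this
    set δ := (n : ℝ) ^ (5 * q) * ((n : ℝ) ^ (20 * q))⁻¹ with hδ
    have hg : ∀ b c, μ.real (⋃ g : Fin q → Fin n × Fin n, ⋃ Z ∈ W r q b c g, ev Z) ≤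
        (n : ℝ) ^ (2 * q) * δ := by
      intro b c
      refine (measureReal_iUnion_fintype_le _).trans ?_
      refine (Finset.sum_le_card_nsmul _ _ _ fun g _ => hW b c g).trans (le_of_eq ?_)
      simp [pow_mul, sq]
    have hc : ∀ b, μ.real (⋃ c : Fin r → Fin n, ⋃ g : Fin q → Fin n × Fin n,
        ⋃ Z ∈ W r q b c g, ev Z) ≤ (n : ℝ) ^ r * ((n : ℝ) ^ (2 * q) * δ) := by
      intro b
      refine (measureReal_iUnion_fintype_le _).trans ?_
      refine (Finset.sum_le_card_nsmul _ _ _ fun c _ => hg b c).trans (le_of_eq ?_)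
      simp
    have hb : μ.real (⋃ b : Fin r → Fin n, ⋃ c : Fin r → Fin n, ⋃ g : Fin q → Fin n × Fin n,
        ⋃ Z ∈ W r q b c g, ev Z) ≤
        (n : ℝ) ^ r * ((n : ℝ) ^ r * ((n : ℝ) ^ (2 * q) * δ)) := by
      refine (measureReal_iUnion_fintype_le _).trans ?_
      refine (Finset.sum_le_card_nsmul _ _ _ fun b _ => hc b).trans (le_of_eq ?_)
      simp
    refine hb.trans ?_
    rw [hδ, le_inv_comm₀ (by positivity) (by positivity), mul_inv, mul_inv, mul_inv, mul_inv, inv_inv]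
    -- The choices of b, c, g and Z number at most n^{r + r + 2q + 5q}. As r ≤ q and 1 ≤ q, the
    -- exponent with the spare 4 is at most 13q, within 20q.
    have h1 : (n : ℝ) ^ 4 * ((n : ℝ) ^ r * ((n : ℝ) ^ r * ((n : ℝ) ^ (2 * q) * (n : ℝ) ^ (5 * q)))) ≤
        (n : ℝ) ^ (20 * q) := by
      simp only [← pow_add]
      exact pow_le_pow_right₀ hn1 (by omega)
    have h2 : 0 < (n : ℝ) ^ r * ((n : ℝ) ^ r * ((n : ℝ) ^ (2 * q) * (n : ℝ) ^ (5 * q))) := by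
      positivity
    calc (n : ℝ) ^ 4 ≤ (n : ℝ) ^ (20 * q) /
          ((n : ℝ) ^ r * ((n : ℝ) ^ r * ((n : ℝ) ^ (2 * q) * (n : ℝ) ^ (5 * q)))) := by
          rw [le_div_iff₀ h2]
          exact h1
      _ = _ := by field_simp
  calc μ.real (sparsePatternEvent n p) ≤ _ := measureReal_mono hsub (measure_ne_top _ _)
    _ ≤ ∑ r ∈ Finset.range (n + 1), ∑ q ∈ Finset.Icc (max 1 r) (n * n), ((n : ℝ) ^ 4)⁻¹ := by
      refine (measureReal_biUnion_finset_le _ _).trans (Finset.sum_le_sum fun r hr => ?_)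
      exact (measureReal_biUnion_finset_le _ _).trans (Finset.sum_le_sum fun q hq => hterm r hr q hq)
    _ ≤ ∑ r ∈ Finset.range (n + 1), ((n : ℝ) ^ 2 * ((n : ℝ) ^ 4)⁻¹) := by
      refine Finset.sum_le_sum fun r _ => ?_
      rw [Finset.sum_const, nsmul_eq_mul, Nat.card_Icc]
      refine mul_le_mul_of_nonneg_right ?_ (by positivity)
      have : n * n + 1 - max 1 r ≤ n ^ 2 := by
        have := le_max_left 1 r
        rw [sq]
        omega
      exact_mod_cast this
    _ ≤ 2 / n := by
      rw [Finset.sum_const, Finset.card_range, nsmul_eq_mul, le_div_iff₀ hn0]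
      push_cast
      field_simp
      linarith

/-! ### Short paths and the number of far indices -/

open Classical in
-- Each step has n choices, except the last, whose endpoint is prescribed. The count is read off
-- from powers of the adjacency matrix.
theorem card_finsetWalkLength_le (n l : ℕ) (u v : BipVertex n) :
    ((bipGraph fun _ : Fin n × Fin n => true).finsetWalkLength (l + 1) u v).card ≤ n ^ l := by
  set G := bipGraph fun _ : Fin n × Fin n => true with hG
  have hone : ∀ u v, G.adjMatrix ℕ u v ≤ 1 := fun u v => by
    rw [SimpleGraph.adjMatrix_apply]
    split_ifs <;> simp
  have hrow : ∀ u, ∑ w, G.adjMatrix ℕ u w ≤ n := by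
    intro u
    rw [Fintype.sum_sum_type]
    have hll : ∀ i j : Fin n, ¬ G.Adj (Sum.inl i) (Sum.inl j) := fun i j h => h
    have hrr : ∀ i j : Fin n, ¬ G.Adj (Sum.inr i) (Sum.inr j) := fun i j h => h
    have hs : ∀ f : Fin n → BipVertex n, ∑ j, G.adjMatrix ℕ u (f j) ≤ n := fun f =>
      (Finset.sum_le_card_nsmul _ _ 1 fun j _ => hone _ _).trans (by simp)
    rcases u with i | i
    · rw [Finset.sum_eq_zero fun j _ => by simp [SimpleGraph.adjMatrix_apply, hll], zero_add]
      exact hs _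
    · rw [add_comm, Finset.sum_eq_zero fun j _ => by simp [SimpleGraph.adjMatrix_apply, hrr],
        zero_add]
      exact hs _
  have hpow : ∀ l u v, (G.adjMatrix ℕ ^ (l + 1)) u v ≤ n ^ l := by
    intro l
    induction l with
    | zero => intro u v; simpa using hone u v
    | succ l ih =>
      intro u v
      rw [pow_succ', Matrix.mul_apply]
      calc _ ≤ ∑ w, G.adjMatrix ℕ u w * n ^ l :=
            Finset.sum_le_sum fun w _ => Nat.mul_le_mul_left _ (ih w v)
        _ ≤ n * n ^ l := by
          rw [← Finset.sum_mul]
          exact Nat.mul_le_mul_right _ (hrow u)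
        _ = n ^ (l + 1) := (pow_succ' n l).symm
  refine le_trans (le_of_eq ?_) (hpow l u v)
  rw [SimpleGraph.adjMatrix_pow_apply_eq_card_walk, ← SimpleGraph.card_set_walk_length_eq]
  simp

open Classical in
/-- The positions of the edges of a walk. -/
noncomputable def walkPairs {n : ℕ} {G : SimpleGraph (BipVertex n)} {u v : BipVertex n}
    (w : G.Walk u v) : Finset (Fin n × Fin n) :=
  Finset.univ.filter fun z => s(Sum.inl z.1, Sum.inr z.2) ∈ w.edges

theorem mem_walkPairs {n : ℕ} {G : SimpleGraph (BipVertex n)} {u v : BipVertex n}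
    {w : G.Walk u v} {z : Fin n × Fin n} :
    z ∈ walkPairs w ↔ s(Sum.inl z.1, Sum.inr z.2) ∈ w.edges := by
  simp [walkPairs]

theorem card_walkPairs {n : ℕ} {E : Fin n × Fin n → Bool} {u v : BipVertex n}
    (w : (bipGraph E).Walk u v) (hw : w.IsPath) : (walkPairs w).card = w.length := by
  classical
  have h1 : w.edges.toFinset = (walkPairs w).image
      fun z => s((Sum.inl z.1 : BipVertex n), Sum.inr z.2) := by
    ext e
    simp only [List.mem_toFinset, Finset.mem_image, mem_walkPairs]
    constructor
    · intro he
      have hadj := w.edges_subset_edgeSet he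
      induction e using Sym2.ind with
      | _ a b =>
        rw [SimpleGraph.mem_edgeSet] at hadj
        rcases a with i | i <;> rcases b with j | j
        · exact hadj.elim
        · exact ⟨(i, j), he, rfl⟩
        · exact ⟨(j, i), by rwa [Sym2.eq_swap], Sym2.eq_swap⟩
        · exact hadj.elim
    · rintro ⟨z, hz, rfl⟩
      exact hz
  rw [← w.length_edges, ← List.toFinset_card_of_nodup hw.isTrail.edges_nodup, h1,
    Finset.card_image_of_injective]
  rintro ⟨i, j⟩ ⟨i', j'⟩ h
  simpa using h

theorem odd_length_of_walk {n : ℕ} {E : Fin n × Fin n → Bool} {i j : Fin n}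
    (w : (bipGraph E).Walk (Sum.inl i) (Sum.inr j)) : Odd w.length := by
  let c : (bipGraph E).Coloring Bool := SimpleGraph.Coloring.mk Sum.isLeft (by
    rintro (a | a) (b | b) h
    · exact h.elim
    · simp
    · simp
    · exact h.elim)
  rw [c.odd_length_iff_not_congr w]
  simp [c, SimpleGraph.Coloring.mk]

/-- An index that is not far is joined by a short path of odd length. -/
theorem exists_path_of_notMem_farIndices {n k : ℕ} {E : Fin n × Fin n → Bool} {i : Fin n}
    (hi : i ∉ farIndices k E) : ∃ t < k, ∃ w : (bipGraph E).Walk (Sum.inl i) (Sum.inr i),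
      w.IsPath ∧ w.length = 2 * t + 1 := by
  rw [mem_farIndices, not_le, graphDist] at hi
  have hlt : (bipGraph E).edist (Sum.inl i) (Sum.inr i) < ((2 * k + 1 : ℕ) : ℕ∞) := by
    exact_mod_cast hi
  have hreach : (bipGraph E).Reachable (Sum.inl i) (Sum.inr i) :=
    SimpleGraph.edist_ne_top_iff_reachable.1 (ne_top_of_lt hlt)
  obtain ⟨w, hw, hlen⟩ := hreach.exists_path_of_dist
  rw [← hreach.coe_dist_eq_edist, ← hlen, Nat.cast_lt] at hlt
  obtain ⟨t, ht⟩ := odd_length_of_walk w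
  exact ⟨t, by omega, w, hw, ht⟩

/-- First moment bound: by bipartiteness only lengths 2t+1 with t < k matter. Paths are counted in
the complete bipartite graph, and since a path repeats no edge, it is present with probability
p^{2t+1}. -/
theorem randomBipartite_notMem_farIndices_le {n : ℕ} (k : ℕ) (p : unitInterval) (i : Fin n) :
    (randomBipartite n p).real {E | i ∉ farIndices k E} ≤
      ∑ t ∈ Finset.range k, (n : ℝ) ^ (2 * t) * (p : ℝ) ^ (2 * t + 1) := by
  classical
  set G := bipGraph fun _ : Fin n × Fin n => true with hG
  let W (t : ℕ) := (G.finsetWalkLength (2 * t + 1) (Sum.inl i) (Sum.inr i)).filter (·.IsPath)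
  have hsub : {E | i ∉ farIndices k E} ⊆ ⋃ t ∈ Finset.range k, ⋃ w ∈ W t,
      {E : Fin n × Fin n → Bool | ∀ z ∈ walkPairs w, E z = true} := by
    intro E hE
    obtain ⟨t, ht, w, hw, hlen⟩ := exists_path_of_notMem_farIndices hE
    have hle : bipGraph E ≤ G := by
      rintro (a | a) (b | b) h
      · exact h.elim
      · rfl
      · rfl
      · exact h.elim
    simp only [Set.mem_iUnion, exists_prop]
    refine ⟨t, Finset.mem_range.2 ht, w.mapLe hle, ?_, fun z hz => ?_⟩
    · refine Finset.mem_filter.2 ⟨?_, hw.mapLe hle⟩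
      rw [SimpleGraph.mem_finsetWalkLength_iff]
      simpa using hlen
    · rw [mem_walkPairs, SimpleGraph.Walk.edges_mapLe_eq_edges] at hz
      exact w.edges_subset_edgeSet hz
  refine (measureReal_mono hsub (measure_ne_top _ _)).trans ((measureReal_biUnion_finset_le _ _).trans ?_)
  refine Finset.sum_le_sum fun t _ => (measureReal_biUnion_finset_le _ _).trans ?_
  refine (Finset.sum_le_card_nsmul _ _ ((p : ℝ) ^ (2 * t + 1)) fun w hw => ?_).trans ?_
  · rw [randomBipartite_cylinder]
    obtain ⟨h1, h2⟩ := Finset.mem_filter.1 hw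
    rw [card_walkPairs w h2, SimpleGraph.mem_finsetWalkLength_iff.1 h1]
    simp
  · rw [nsmul_eq_mul]
    refine mul_le_mul_of_nonneg_right ?_ (pow_nonneg p.2.1 _)
    exact_mod_cast (Finset.card_filter_le _ _).trans (card_finsetWalkLength_le n (2 * t) _ _)

/-- Markov's inequality for the number of indices that are not far, whose mean is at most nδ. -/
theorem randomBipartite_card_farIndices_lt_le {n k : ℕ} (hn : 0 < n) (p : unitInterval) {δ : ℝ}
    (hδ : ∀ i : Fin n, (randomBipartite n p).real {E | i ∉ farIndices k E} ≤ δ) :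
    (randomBipartite n p).real {E | 2 * (farIndices k E).card < n} ≤ 2 * δ := by
  classical
  set μ := randomBipartite n p with hμ
  have hmeas : ∀ S : Set (Fin n × Fin n → Bool), MeasurableSet S := fun S => S.toFinite.measurableSet
  let f : (Fin n × Fin n → Bool) → ℝ := fun E =>
    ∑ i : Fin n, {E | i ∉ farIndices k E}.indicator (fun _ => (1 : ℝ)) E
  have hf : ∀ E, f E = n - (farIndices k E).card := by
    intro E
    have h1 : f E = ((Finset.univ.filter fun i => i ∉ farIndices k E).card : ℝ) := by
      simp only [f, Set.indicator_apply, Set.mem_ofPred_eq, Finset.card_filter]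
      push_cast
      rfl
    have h2 := Finset.card_filter_add_card_filter_not (s := (Finset.univ : Finset (Fin n)))
      (fun i => i ∈ farIndices k E)
    rw [Finset.filter_mem_eq_inter, Finset.univ_inter, Finset.card_univ, Fintype.card_fin] at h2
    rw [h1, eq_sub_iff_add_eq, add_comm]
    exact_mod_cast h2
  have hint : ∀ i : Fin n,
      Integrable ({E | i ∉ farIndices k E}.indicator fun _ => (1 : ℝ)) μ := fun i =>
    (integrable_const 1).indicator (hmeas _)
  have hsum : ∫ E, f E ∂μ ≤ n * δ := by
    simp only [f]
    rw [integral_finsetSum _ fun i _ => hint i]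
    refine (Finset.sum_le_card_nsmul _ _ δ fun i _ => ?_).trans (by simp)
    rw [integral_indicator_const _ (hmeas _), smul_eq_mul, mul_one]
    exact hδ i
  have hmarkov := mul_meas_ge_le_integral_of_nonneg (μ := μ) (f := f)
    (Filter.Eventually.of_forall fun E => Finset.sum_nonneg fun i _ =>
      Set.indicator_nonneg (fun _ _ => zero_le_one) _)
    (integrable_finsetSum _ fun i _ => hint i) ((n : ℝ) / 2)
  have hsub : {E | 2 * (farIndices k E).card < n} ⊆ {E | (n : ℝ) / 2 ≤ f E} := by
    intro E hE
    have h1 : ((2 * (farIndices k E).card : ℕ) : ℝ) < n := by exact_mod_cast hE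
    push_cast at h1
    rw [Set.mem_ofPred_eq, hf]
    linarith
  have h1 := measureReal_mono (μ := μ) hsub
  have hn' : (0 : ℝ) < n := by exact_mod_cast hn
  have h2 : (n : ℝ) / 2 * μ.real {E | (n : ℝ) / 2 ≤ f E} ≤ n * δ := hmarkov.trans hsum
  have h3 : μ.real {E | (n : ℝ) / 2 ≤ f E} ≤ 2 * δ := by
    refine le_of_mul_le_mul_left ?_ hn'
    linarith
  exact h1.trans h3

/-! ### Choice of parameters and conclusion -/

/-- Outside of two events of small probability, the lower bound for sketches holds. -/
theorem afnSketchBound_of_notMem {n k : ℕ} {c K : ℝ} {p : unitInterval}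
    (hn : 3 ≤ n) (hK : K ≤ n) (hk : 1 ≤ k) (hc1 : 1 < c) (hc : c ≤ 2 * (k : ℝ) + 1)
    {E : Fin n × Fin n → Bool} (hfar : n ≤ 2 * (farIndices k E).card)
    (hE : E ∉ sparsePatternEvent n p) :
    AFNSketchBound k c K (1 / 100 * (n * p / Real.log n)) E := by
  have hI : (farIndices k E).Nonempty := Finset.card_pos.1 (by omega)
  refine ⟨hI, fun s M U hU hM hMU T Dec hT herr => ?_⟩
  by_contra! hs
  have hn0 : (0 : ℝ) < n := by exact_mod_cast (by omega : 0 < n)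
  have hn1 : (1 : ℝ) ≤ n := by exact_mod_cast (by omega : 1 ≤ n)
  have hlog : 0 < Real.log n := Real.log_pos (by exact_mod_cast (by omega : 1 < n))
  have hT' : ∀ a b, |T a b| ≤ ((2 * n) ^ (2 * n) : ℕ) := by
    intro a b
    have h1 : (|T a b| : ℝ) ≤ ((2 * n) ^ (2 * n) : ℕ) := by
      refine (hT a b).trans ?_
      push_cast
      rw [two_mul n, pow_add]
      refine mul_le_mul_of_nonneg_right ?_ (by positivity)
      calc K ≤ n := hK
        _ ≤ 2 * n := by linarith
        _ ≤ (2 * (n : ℝ)) ^ n := le_self_pow₀ (by linarith) (by omega)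
    exact_mod_cast h1
  obtain ⟨A, hrank, hdiag, hA⟩ := exists_matrix_of_notMem_span (farIndices k E) E
    (fun j a => (T a (Sum.inl j) : ℚ)) fun i hi =>
      notMem_span_of_error_le hI hU (by omega) hk hc1 hc hM hMU T Dec hT' herr hi
  obtain ⟨r, q, b, d, g, Z, hZ, hq1, hrq, hrn, hqn, hnq, hZA⟩ :=
    exists_skeletonPattern A hrank (farIndices k E) hfar hI hdiag
  refine hE ⟨r, q, b, d, g, Z, hZ, hq1, hrq, hrn, hqn, ?_, fun z hz => hA z.1 z.2 (hZA z hz)⟩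
  have hq : (0 : ℝ) < q := by exact_mod_cast hq1
  have hp : (0 : ℝ) ≤ p := p.2.1
  have h1 : (n * q : ℝ) ≤ 4 * s * Z.card := by exact_mod_cast hnq
  have hs0 : (0 : ℝ) < s := by
    rw [Nat.cast_pos, Nat.pos_iff_ne_zero]
    rintro rfl
    have : 0 < (n : ℝ) * q := mul_pos hn0 hq
    simp at h1
    linarith
  have h2 : 100 * s * Real.log n ≤ n * p := by
    have h3 : (s : ℝ) * 100 ≤ n * p / Real.log n := by linarith
    rw [le_div_iff₀ hlog] at h3
    linarith
  -- If s is below np/(100 log n), the support size nq/(4s) gives p |Z| ≥ 25 q log n, more than the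
  -- required 20 q log n.
  have h4 : (4 * s) * (25 * q * Real.log n) ≤ (4 * s) * (p * Z.card) := by
    calc (4 * s) * (25 * q * Real.log n) = q * (100 * s * Real.log n) := by ring
      _ ≤ q * (n * p) := mul_le_mul_of_nonneg_left h2 hq.le
      _ = p * (n * q) := by ring
      _ ≤ p * (4 * s * Z.card) := mul_le_mul_of_nonneg_left h1 hp
      _ = _ := by ring
  have h5 := le_of_mul_le_mul_left h4 (by positivity)
  have h6 : 0 ≤ q * Real.log n := by positivity
  linarith

/-- The expected number of short paths is small for the edge probability of the theorem. -/
theorem sum_pow_le_of_log {n k : ℕ} (hn : 8 ≤ n) (hk : 1 ≤ k) {p : ℝ}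
    (hp : p = (n : ℝ) ^ (1 / (2 * (k : ℝ) - 1) - 1) / Real.log (n : ℝ) ^ 5) :
    ∑ t ∈ Finset.range k, (n : ℝ) ^ (2 * t) * p ^ (2 * t + 1) ≤ 2 / Real.log n ^ 5 := by
  have hn0 : (0 : ℝ) < n := by exact_mod_cast (by omega : 0 < n)
  have hn1 : (1 : ℝ) ≤ n := by exact_mod_cast (by omega : 1 ≤ n)
  have hk1 : (1 : ℝ) ≤ k := by exact_mod_cast hk
  have hlog : 2 ≤ Real.log n := by
    have h1 : Real.log 8 ≤ Real.log n := Real.log_le_log (by norm_num) (by exact_mod_cast hn)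
    have h2 : Real.log 8 = 3 * Real.log 2 := by
      rw [show (8 : ℝ) = 2 ^ 3 by norm_num, Real.log_pow]
      norm_num
    have := Real.log_two_gt_d9
    linarith
  set x := (Real.log n ^ 5)⁻¹ with hx
  have hx0 : 0 < x := by positivity
  have hx2 : x ≤ 1 / 2 := by
    rw [hx, inv_le_comm₀ (by positivity) (by norm_num)]
    calc (1 / 2 : ℝ)⁻¹ = 2 := by norm_num
      _ ≤ Real.log n := hlog
      _ ≤ Real.log n ^ 5 := le_self_pow₀ (by linarith) (by norm_num)
  set y := (n : ℝ) ^ (1 / (2 * (k : ℝ) - 1)) with hy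
  have hpos : 0 < 2 * (k : ℝ) - 1 := by linarith
  have hy1 : 1 ≤ y := Real.one_le_rpow hn1 (by positivity)
  have hyn : y ^ (2 * k - 1) = n := by
    rw [hy, ← Real.rpow_natCast, ← Real.rpow_mul hn0.le, Nat.cast_sub (by omega)]
    push_cast
    rw [one_div, inv_mul_cancel₀ hpos.ne', Real.rpow_one]
  have hnp : n * p = y * x := by
    rw [hp, Real.rpow_sub hn0, Real.rpow_one, ← hy, hx]
    field_simp
  -- Here np = yx with y^{2k-1} = n, so y^{2t+1} ≤ n for t < k. The powers of x ≤ 1/2 supply a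
  -- geometric series, which makes the bound uniform in k.
  have hterm : ∀ t ∈ Finset.range k, (n : ℝ) ^ (2 * t) * p ^ (2 * t + 1) ≤ x * (1 / 2) ^ t := by
    intro t ht
    rw [Finset.mem_range] at ht
    refine le_of_mul_le_mul_left ?_ hn0
    calc (n : ℝ) * ((n : ℝ) ^ (2 * t) * p ^ (2 * t + 1)) = (n * p) ^ (2 * t + 1) := by ring
      _ = y ^ (2 * t + 1) * x ^ (2 * t + 1) := by rw [hnp, mul_pow]
      _ ≤ n * (x * (1 / 2) ^ t) := by
        refine mul_le_mul ?_ ?_ (by positivity) hn0.le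
        · rw [← hyn]
          exact pow_le_pow_right₀ hy1 (by omega)
        · calc x ^ (2 * t + 1) = x * (x ^ t * x ^ t) := by ring
            _ ≤ x * ((1 / 2) ^ t * 1) := by
              gcongr
              exact pow_le_one₀ hx0.le (by linarith)
            _ = _ := by ring
  calc _ ≤ ∑ t ∈ Finset.range k, x * (1 / 2) ^ t := Finset.sum_le_sum hterm
    _ = x * ∑ t ∈ Finset.range k, (1 / 2 : ℝ) ^ t := by rw [Finset.mul_sum]
    _ ≤ x * 2 := mul_le_mul_of_nonneg_left (sum_geometric_two_le k) hx0.le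
    _ = _ := by rw [hx]; ring

theorem randomBipartite_afnSketchBound {n k : ℕ} {c K : ℝ} {p : unitInterval}
    (hn : 8 ≤ n) (hK : K ≤ n) (hk : 1 ≤ k) (hc1 : 1 < c) (hc : c ≤ 2 * (k : ℝ) + 1)
    (hp : (p : ℝ) = (n : ℝ) ^ (1 / (2 * (k : ℝ) - 1) - 1) / Real.log (n : ℝ) ^ 5) :
    1 - (4 / Real.log n ^ 5 + 2 / n) ≤ (randomBipartite n p).real
      {E | AFNSketchBound k c K (1 / 100 * (n * p / Real.log n)) E} := by
  set μ := randomBipartite n p with hμ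
  set good := {E | AFNSketchBound k c K (1 / 100 * (n * p / Real.log n)) E} with hgood
  have hcover : (Set.univ : Set (Fin n × Fin n → Bool)) ⊆
      good ∪ ({E | 2 * (farIndices k E).card < n} ∪ sparsePatternEvent n p) := by
    intro E _
    by_cases h1 : 2 * (farIndices k E).card < n
    · exact Or.inr (Or.inl h1)
    by_cases h2 : E ∈ sparsePatternEvent n p
    · exact Or.inr (Or.inr h2)
    · exact Or.inl (afnSketchBound_of_notMem (by omega) hK hk hc1 hc (not_lt.1 h1) h2)
  have h1 : μ.real {E | 2 * (farIndices k E).card < n} ≤ 2 * (2 / Real.log n ^ 5) :=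
    randomBipartite_card_farIndices_lt_le (by omega) p fun i =>
      (randomBipartite_notMem_farIndices_le k p i).trans (sum_pow_le_of_log hn hk hp)
  have h2 : μ.real (sparsePatternEvent n p) ≤ 2 / n :=
    randomBipartite_sparsePatternEvent_le (by omega) p
  have h3 := measureReal_mono (μ := μ) hcover
  rw [probReal_univ] at h3
  have h4 := measureReal_union_le (μ := μ) good
    ({E | 2 * (farIndices k E).card < n} ∪ sparsePatternEvent n p)
  have h5 := measureReal_union_le (μ := μ) {E | 2 * (farIndices k E).card < n}
    (sparsePatternEvent n p)
  have h6 : 2 * (2 / Real.log n ^ 5) = 4 / Real.log n ^ 5 := by ring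
  linarith

theorem mainTheorem6 :
    ∃ (a : ℕ) (C : ℝ), 0 < C ∧
      ∀ K : ℝ, ∃ ε : ℕ → ℝ, Filter.Tendsto ε Filter.atTop (nhds 0) ∧
        ∀ (n k : ℕ) (c : ℝ) (p : unitInterval), 1 ≤ k → 1 < c → c ≤ 2 * (k : ℝ) + 1 →
          (p : ℝ) = (n : ℝ) ^ (1 / (2 * (k : ℝ) - 1) - 1) / Real.log (n : ℝ) ^ 5 →
          1 - ε n ≤ (randomBipartite n p).real
            {E | AFNSketchBound k c K
              (C * (n : ℝ) ^ (1 / (2 * (k : ℝ) - 1)) / Real.log (n : ℝ) ^ a) E} := by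
  -- Five logarithms come from p and the sixth from the union bound over patterns.
  refine ⟨6, 1 / 100, by norm_num, fun K => ?_⟩
  obtain ⟨N, hN⟩ := exists_nat_ge K
  -- For small n the value 1 makes the claim trivial. The threshold N ≥ K absorbs K into the entry
  -- bound (2n)^{2n}.
  refine ⟨fun n => if max 8 N ≤ n then 4 / Real.log n ^ 5 + 2 / n else 1, ?_, ?_⟩
  · have h1 : Filter.Tendsto (fun n : ℕ => 4 / Real.log n ^ 5 + 2 / (n : ℝ)) Filter.atTop
        (nhds (0 + 0)) := by
      refine Filter.Tendsto.add ?_ (tendsto_const_div_atTop_nhds_zero_nat 2)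
      refine Filter.Tendsto.const_div_atTop ?_ 4
      exact (Filter.tendsto_pow_atTop (by norm_num)).comp
        (Real.tendsto_log_atTop.comp tendsto_natCast_atTop_atTop)
    rw [add_zero] at h1
    refine h1.congr' ?_
    filter_upwards [Filter.eventually_ge_atTop (max 8 N)] with n hn
    rw [if_pos hn]
  · intro n k c p hk hc1 hc hp
    simp only
    split_ifs with hn
    · have hn8 : 8 ≤ n := (le_max_left 8 N).trans hn
      have hKn : K ≤ n := hN.trans (by exact_mod_cast (le_max_right 8 N).trans hn)
      have hn0 : (0 : ℝ) < n := by exact_mod_cast (by omega : 0 < n)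
      have hlog : Real.log n ≠ 0 :=
        (Real.log_pos (by exact_mod_cast (by omega : 1 < n))).ne'
      have hB : 1 / 100 * (n : ℝ) ^ (1 / (2 * (k : ℝ) - 1)) / Real.log (n : ℝ) ^ 6 =
          1 / 100 * (n * p / Real.log n) := by
        rw [hp, Real.rpow_sub hn0, Real.rpow_one]
        field_simp
      rw [hB]
      exact randomBipartite_afnSketchBound hn8 hKn hk hc1 hc hp
    · simp
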